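/- Fix an infinite set $\mathbb D$ of data values. The emptiness problem for alternating one-register tree automata with $\mathsf{guess}$ and $\mathsf{spread}$ is decidable: there is an algorithm that, given (a finite description of) an automaton $\mathcal A\in\mathsf{ATRA}(\mathsf{guess},\mathsf{spread})$, decides whether $\mathcal L(\mathcal A)=\emptyset$. Here the notions are the following. **Data trees.** A data tree $T$ over a finite alphabet $\mathbb A$ is a finite nonempty ordered unranked tree each of whose nodes $x$ carries a pair $T(x)\in\mathbb A\times\mathbb D$. The type of a node records whether it has a child ($\triangledown$ or $\bar\triangledown$) and whether it has a next sibling to its right ($\rhd$ or $\bar\rhd$). **Automata.** An automaton is $\mathcal A=\langle\mathbb A,Q,q_I,\delta\rangle$ with $\mathbb A$, $Q$ finite, $q_I\in Q$, and $\delta$ mapping each state to one of the instructions $$a\mid \bar a\mid \odot?\mid \mathsf{store}(q)\mid \mathsf{eq}\mid\overline{\mathsf{eq}}\mid q\wedge q'\mid q\vee q'\mid \triangledown q\mid \rhd q\mid \mathsf{guess}(q)\mid \mathsf{spread}(q,q')$$ with $a\in\mathbb A$, $q,q'\in Q$, $\odot\in\{\triangledown,\bar\triangledown,\rhd,\bar\rhd\}$.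 The instructions $\triangledown q$ and $\rhd q$ are called moving. **Configurations.** A node configuration is $\langle x,\alpha,(a,d),\Delta\rangle$ with $x$ a position, $\alpha$ a type, $a\in\mathbb A$, $d\in\mathbb D$, and $\Delta\subseteq Q\times\mathbb D$ a finite set of threads (a state and a register value). A tree configuration is a finite set of node configurations. **Non-moving steps** $\to_\varepsilon$. From $\langle x,\alpha,(a,d),\{(q,d')\}\cup\Delta\rangle$ one may go to $\langle x,\alpha,(a,d),N\cup\Delta\rangle$, where: $N=\{(q_1,d')\}$ or $N=\{(q_2,d')\}$ if $\delta(q)=q_1\vee q_2$; $N=\{(q_1,d'),(q_2,d')\}$ if $\delta(q)=q_1\wedge q_2$; $N=\{(q',d)\}$ if $\delta(q)=\mathsf{store}(q')$; $N=\{(q',e)\}$ for any $e\in\mathbb D$ if $\delta(q)=\mathsf{guess}(q')$; $N=\emptyset$ if $\delta(q)$ is a test that holds ($\mathsf{eq}$: $d=d'$; $\overline{\mathsf{eq}}$: $d\ne d'$; $\odot?$: $\odot$ occurs in $\alpha$; $b$: $b=a$; $\bar b$: $b\neq a$); and $N=\{(q_1,e)\mid (q_2,e)\in\Delta\}$ if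 $\delta(q)=\mathsf{spread}(q_2,q_1)$, provided that every thread of $\Delta$ has a $\mathsf{spread}$ or a moving instruction. **Moving steps.** If all threads of $\rho=\langle x,\alpha,\gamma,\Delta\rangle$ are moving, then, when $\alpha$ contains $\triangledown$, $\rho\to_\triangledown\langle y,\alpha_1,\gamma_1,\{(q',d)\mid (q,d)\in\Delta,\ \delta(q)=\triangledown q'\}\rangle$ with $y$ the first-child position of $x$ and $\alpha_1,\gamma_1$ arbitrary, and, when $\alpha$ contains $\rhd$, $\rho\to_\rhd\langle z,\alpha_1,\gamma_1,\{(q',d)\mid (q,d)\in\Delta,\ \delta(q)=\rhd q'\}\rangle$ with $z$ the next-sibling position of $x$. **Runs.** A step of tree configurations goes from $\{\rho\}\cup\mathcal S$ to $\{\tau\}\cup\mathcal S$, where $\rho\to_\varepsilon\tau$, or $\rho$ has type $(\triangledown,\bar\rhd)$ and $\rho\to_\triangledown\tau$, or $\rho$ has type $(\bar\triangledown,\rhd)$ and $\rho\to_\rhd\tau$; or from $\{\rho\}\cup\mathcal S$ to $\{\tau_1,\tau_2\}\cup\mathcal S$, where $\rho$ has type $(\triangledown,\rhd)$, $\rho\to_\triangledown\tau_1$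 and $\rho\to_\rhd\tau_2$. A run over a data tree $T$ is a nonempty finite sequence of tree configurations, each obtained from the previous one by such a step, whose first element consists of one node configuration at the root with the single thread $(q_I,d_0)$, $d_0$ the datum of the root, such that every node configuration $\langle x,\alpha,\gamma,\Delta\rangle$ occurring in it satisfies $x\in\mathrm{pos}(T)$, $\gamma=T(x)$ and $\alpha=\mathrm{type}_T(x)$. It is accepting if in its last tree configuration all node configurations have $\Delta=\emptyset$. $\mathcal L(\mathcal A)$ is the set of data trees over which $\mathcal A$ has an accepting run. -/

import Mathlib

universe u v w

namespace ATRA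

/-! ### Data trees -/

/-- A data tree: a finite, ordered, unranked, nonempty tree whose nodes carry a letter and a datum.
A position is a sequence of indices; the children of `x` are `x ++ [0], x ++ [1], …`
(siblings are numbered from left to right, starting with `0`). -/
structure DataTree (Alph : Type v) (D : Type u) where
  pos : Finset (List ℕ)
  root_mem : [] ∈ pos
  prefix_closed : ∀ x y, x ++ y ∈ pos → x ∈ pos
  sibling_closed : ∀ x i, x ++ [i + 1] ∈ pos → x ++ [i] ∈ pos
  label : {x // x ∈ pos} → Alph × D

/-- A tree type: does the node have a child, does it have a sibling to its right? -/
structure TreeType where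
  child : Bool
  sibling : Bool

/-- `α` is the type of the position `x` in the tree. -/
def DataTree.HasType {Alph : Type v} {D : Type u} (T : DataTree Alph D) (x : List ℕ)
    (α : TreeType) : Prop :=
  (α.child = true ↔ x ++ [0] ∈ T.pos) ∧
  (α.sibling = true ↔ ∃ x' i, x = x' ++ [i] ∧ x' ++ [i + 1] ∈ T.pos)

/-! ### Automata -/

/-- The four tests on the type of the current node. -/
inductive TypeTest
  | child
  | noChild
  | sibling
  | noSibling

/-- The type `α` passes the test. -/
def TypeTest.Holds : TypeTest → TreeType → Prop
  | .child, α => α.child = true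
  | .noChild, α => α.child = false
  | .sibling, α => α.sibling = true
  | .noSibling, α => α.sibling = false

/-- The right-hand sides of the transition function. -/
inductive Instr (Alph : Type v) (Q : Type w)
  | letter (a : Alph)
  | notLetter (a : Alph)
  | test (b : TypeTest)
  | store (q : Q)
  | eq
  | neq
  | and (q q' : Q)
  | or (q q' : Q)
  | down (q : Q)
  | right (q : Q)
  | guess (q : Q)
  | spread (q q' : Q)

/-- The moving instructions: go to the leftmost child, go to the next sibling to the right. -/
def Instr.IsMoving {Alph : Type v} {Q : Type w} (φ : Instr Alph Q) : Prop :=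
  (∃ q, φ = .down q) ∨ (∃ q, φ = .right q)

def Instr.IsSpread {Alph : Type v} {Q : Type w} (φ : Instr Alph Q) : Prop :=
  ∃ q q', φ = .spread q q'

/-- An alternating tree one-register automaton with `guess` and `spread`, with alphabet `Alph` and
set of states `Q`; finiteness of both is required where automata are quantified over. -/
structure Automaton (Alph : Type v) (Q : Type w) where
  init : Q
  δ : Q → Instr Alph Q

/-! ### Configurations and runs -/

/-- A node configuration `⟨x, α, (a, d), Δ⟩`; a thread is a state together with a register value. -/
structure NodeConf (Alph : Type v) (Q : Type w) (D : Type u) where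
  pos : List ℕ
  type : TreeType
  letter : Alph
  datum : D
  threads : Finset (Q × D)

/-- A tree configuration is a finite set of node configurations. -/
abbrev TreeConf (Alph : Type v) (Q : Type w) (D : Type u) := Finset (NodeConf Alph Q D)

section Semantics

variable {Alph : Type v} {Q : Type w} {D : Type u}

/-- `ThreadStep A α a d t N`: at a node of type `α` with letter `a` and datum `d`, the thread `t`
can be replaced by the set of threads `N` (all non-moving instructions except `spread`). -/
inductive ThreadStep (A : Automaton Alph Q) (α : TreeType) (a : Alph) (d : D) :
    Q × D → Set (Q × D) → Prop
  | or_left {q q₁ q₂ : Q} {d' : D} : A.δ q = .or q₁ q₂ → ThreadStep A α a d (q, d') {(q₁, d')}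
  | or_right {q q₁ q₂ : Q} {d' : D} : A.δ q = .or q₁ q₂ → ThreadStep A α a d (q, d') {(q₂, d')}
  | and {q q₁ q₂ : Q} {d' : D} :
      A.δ q = .and q₁ q₂ → ThreadStep A α a d (q, d') {(q₁, d'), (q₂, d')}
  | store {q q' : Q} {d' : D} : A.δ q = .store q' → ThreadStep A α a d (q, d') {(q', d)}
  | eq {q : Q} {d' : D} : A.δ q = .eq → d = d' → ThreadStep A α a d (q, d') ∅
  | neq {q : Q} {d' : D} : A.δ q = .neq → d ≠ d' → ThreadStep A α a d (q, d') ∅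
  | test {q : Q} {d' : D} {b : TypeTest} :
      A.δ q = .test b → b.Holds α → ThreadStep A α a d (q, d') ∅
  | letter {q : Q} {d' : D} {b : Alph} :
      A.δ q = .letter b → b = a → ThreadStep A α a d (q, d') ∅
  | notLetter {q : Q} {d' : D} {b : Alph} :
      A.δ q = .notLetter b → b ≠ a → ThreadStep A α a d (q, d') ∅
  | guess {q q' : Q} {d' : D} (e : D) :
      A.δ q = .guess q' → ThreadStep A α a d (q, d') {(q', e)}

/-- The non-moving relation between node configurations. -/
inductive EpsStep (A : Automaton Alph Q) : NodeConf Alph Q D → NodeConf Alph Q D → Prop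
  | thread {x : List ℕ} {α : TreeType} {a : Alph} {d : D} {Γ Γ' Δ : Finset (Q × D)}
      {t : Q × D} {N : Set (Q × D)} :
      (Γ : Set (Q × D)) = {t} ∪ ↑Δ → ThreadStep A α a d t N → (Γ' : Set (Q × D)) = N ∪ ↑Δ →
      EpsStep A ⟨x, α, a, d, Γ⟩ ⟨x, α, a, d, Γ'⟩
  | spread {x : List ℕ} {α : TreeType} {a : Alph} {d : D} {Γ Γ' Δ : Finset (Q × D)}
      {q q₁ q₂ : Q} {d' : D} :
      (Γ : Set (Q × D)) = {(q, d')} ∪ ↑Δ → A.δ q = .spread q₂ q₁ →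
      (∀ t ∈ Δ, (A.δ t.1).IsSpread ∨ (A.δ t.1).IsMoving) →
      (Γ' : Set (Q × D)) = {t | t.1 = q₁ ∧ (q₂, t.2) ∈ Δ} ∪ ↑Δ →
      EpsStep A ⟨x, α, a, d, Γ⟩ ⟨x, α, a, d, Γ'⟩

/-- A node configuration is moving if all its threads are. -/
def NodeConf.IsMoving (A : Automaton Alph Q) (ρ : NodeConf Alph Q D) : Prop :=
  ∀ t ∈ ρ.threads, (A.δ t.1).IsMoving

/-- The first-child relation between node configurations. -/
def ChildStep (A : Automaton Alph Q) (ρ τ : NodeConf Alph Q D) : Prop :=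
  ρ.type.child = true ∧ τ.pos = ρ.pos ++ [0] ∧ ρ.IsMoving A ∧
  (τ.threads : Set (Q × D)) = {t | ∃ q, (q, t.2) ∈ ρ.threads ∧ A.δ q = .down t.1}

/-- The next-sibling relation between node configurations. -/
def SiblingStep (A : Automaton Alph Q) (ρ τ : NodeConf Alph Q D) : Prop :=
  ρ.type.sibling = true ∧ (∃ x i, ρ.pos = x ++ [i] ∧ τ.pos = x ++ [i + 1]) ∧ ρ.IsMoving A ∧
  (τ.threads : Set (Q × D)) = {t | ∃ q, (q, t.2) ∈ ρ.threads ∧ A.δ q = .right t.1}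

/-- The transition relation between tree configurations. -/
inductive TreeStep (A : Automaton Alph Q) : TreeConf Alph Q D → TreeConf Alph Q D → Prop
  | eps {S₁ S₂ S : TreeConf Alph Q D} {ρ τ : NodeConf Alph Q D} :
      (S₁ : Set (NodeConf Alph Q D)) = {ρ} ∪ ↑S → (S₂ : Set (NodeConf Alph Q D)) = {τ} ∪ ↑S →
      EpsStep A ρ τ → TreeStep A S₁ S₂
  | child {S₁ S₂ S : TreeConf Alph Q D} {ρ τ : NodeConf Alph Q D} :
      (S₁ : Set (NodeConf Alph Q D)) = {ρ} ∪ ↑S → (S₂ : Set (NodeConf Alph Q D)) = {τ} ∪ ↑S →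
      ρ.type = ⟨true, false⟩ → ChildStep A ρ τ → TreeStep A S₁ S₂
  | sibling {S₁ S₂ S : TreeConf Alph Q D} {ρ τ : NodeConf Alph Q D} :
      (S₁ : Set (NodeConf Alph Q D)) = {ρ} ∪ ↑S → (S₂ : Set (NodeConf Alph Q D)) = {τ} ∪ ↑S →
      ρ.type = ⟨false, true⟩ → SiblingStep A ρ τ → TreeStep A S₁ S₂
  | both {S₁ S₂ S : TreeConf Alph Q D} {ρ τ₁ τ₂ : NodeConf Alph Q D} :
      (S₁ : Set (NodeConf Alph Q D)) = {ρ} ∪ ↑S →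
      (S₂ : Set (NodeConf Alph Q D)) = {τ₁, τ₂} ∪ ↑S →
      ρ.type = ⟨true, true⟩ → ChildStep A ρ τ₁ → SiblingStep A ρ τ₂ → TreeStep A S₁ S₂

/-- The node configuration carries the right type, letter and datum for its position in `T`. -/
def NodeConf.IsOver (T : DataTree Alph D) (ρ : NodeConf Alph Q D) : Prop :=
  (∃ h : ρ.pos ∈ T.pos, (ρ.letter, ρ.datum) = T.label ⟨ρ.pos, h⟩) ∧ T.HasType ρ.pos ρ.type

/-- `S 0, …, S n` is a run of `A` over `T`. -/
def IsRun (A : Automaton Alph Q) (T : DataTree Alph D) (n : ℕ)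
    (S : Fin (n + 1) → TreeConf Alph Q D) : Prop :=
  (∃ α a d, S 0 = {⟨[], α, a, d, {(A.init, d)}⟩}) ∧
  (∀ i : Fin n, TreeStep A (S i.castSucc) (S i.succ)) ∧
  (∀ i, ∀ ρ ∈ S i, ρ.IsOver T)

/-- The set of data trees over which `A` has an accepting run. -/
def Automaton.language (A : Automaton Alph Q) (D : Type u) : Set (DataTree Alph D) :=
  {T | ∃ n S, IsRun A T n S ∧ ∀ ρ ∈ S (Fin.last n), ρ.threads = ∅}

end Semantics

/-! ### Automata as inputs of an algorithm -/

/-- A finite description of an automaton: the number of letters, the number of the initial state,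
and the list of the instructions of all states, each given by an opcode and two arguments. -/
abbrev Code := ℕ × ℕ × List (ℕ × ℕ × ℕ)

def TypeTest.code : TypeTest → ℕ
  | .child => 0
  | .noChild => 1
  | .sibling => 2
  | .noSibling => 3

/-- Opcode and arguments of an instruction, for an alphabet and a set of states that are numbered
by `eA` and `eQ`. -/
def Instr.code {Alph : Type v} {Q : Type w} {k m : ℕ} (eA : Alph ≃ Fin k) (eQ : Q ≃ Fin m) :
    Instr Alph Q → ℕ × ℕ × ℕ
  | .letter a => (0, eA a, 0)
  | .notLetter a => (1, eA a, 0)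
  | .test b => (2, b.code, 0)
  | .store q => (3, eQ q, 0)
  | .eq => (4, 0, 0)
  | .neq => (5, 0, 0)
  | .and q q' => (6, eQ q, eQ q')
  | .or q q' => (7, eQ q, eQ q')
  | .down q => (8, eQ q, 0)
  | .right q => (9, eQ q, 0)
  | .guess q => (10, eQ q, 0)
  | .spread q q' => (11, eQ q, eQ q')

/-- The description of an automaton whose letters are numbered `0, …, k - 1` by `eA` and whose
states are numbered `0, …, m - 1` by `eQ`. -/
def Automaton.code {Alph : Type v} {Q : Type w} {k m : ℕ} (A : Automaton Alph Q)
    (eA : Alph ≃ Fin k) (eQ : Q ≃ Fin m) : Code :=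
  (k, eQ A.init, List.ofFn fun i => (A.δ (eQ.symm i)).code eA eQ)

end ATRA

/-! Nonemptiness and emptiness are both semi-decidable: each is equivalent to the existence of a
finite certificate that can be checked primitive recursively. Post's theorem then yields a decision
procedure.

The branches of a run do not interact. Hence an accepting run exists exactly if some initial node
configuration is winning, that is, its threads can be eliminated by a finite derivation (`Good`)
that chooses freely the types, letters and data of the nodes it visits (`language_nonempty_iff`).
For finite thread sets, winning survives injective renaming of data and removal of threads. Both
facts, and the passage from an automaton over `D` to a coded one over `ℕ`, are instances of one
simulation lemma, `Corr.good`.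

A certificate of nonemptiness is a derivation written as a list
(`codeNonempty_iff_exists_goodCert`).

A certificate of emptiness is a finite list of losing configurations such that every step from a
member meets a configuration lying above a member, i.e. with the same type, letter and datum and at
least its threads. A shortest derivation of a win from a member is then impossible. Such lists exist
by a well-quasi-order argument. Up to renaming, a configuration is described by its type, its
letter, the set of states at the datum of the node, and, for each set of states, the number of other
data that carry exactly this set. With boundedly many states and letters, Dickson's lemma applies to
these descriptions. As losing is inherited by larger thread sets, there is an `N` such that every
losing configuration contains a losing one with at most `N` data (`exists_small_bad`). The losing
configurations with at most `N` data, all taken below `N + 1`, form the certificate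
(`exists_badCert`): one value below `N + 1` is always unused and can represent every datum outside
the range. -/

namespace ATRA

/-! ### Winning node configurations -/

section Winning

universe v₂ w₂ u₂

variable {Alph : Type v} {Q : Type w} {D : Type u}

/-- The threads that move to the first child. -/
def downSet (A : Automaton Alph Q) (Γ : Set (Q × D)) : Set (Q × D) :=
  {t | ∃ q, (q, t.2) ∈ Γ ∧ A.δ q = .down t.1}

/-- The threads that move to the next sibling. -/
def rightSet (A : Automaton Alph Q) (Γ : Set (Q × D)) : Set (Q × D) :=
  {t | ∃ q, (q, t.2) ∈ Γ ∧ A.δ q = .right t.1}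

/-- The threads created by `spread q₂ q₁`. -/
def spreadSet (q₂ q₁ : Q) (Δ : Set (Q × D)) : Set (Q × D) :=
  {t | t.1 = q₁ ∧ (q₂, t.2) ∈ Δ}

/-- `Pre A L P` holds of a node configuration without threads, and of one from which a single step
leads to node configurations with `P`, where the letters of new nodes are taken from `L`. -/
inductive Pre (A : Automaton Alph Q) (L : Set Alph)
    (P : TreeType → Alph → D → Set (Q × D) → Prop) :
    TreeType → Alph → D → Set (Q × D) → Prop
  | empty {α : TreeType} {a : Alph} {d : D} : Pre A L P α a d ∅
  | thread {α : TreeType} {a : Alph} {d : D} {Γ N : Set (Q × D)} {t : Q × D} :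
      t ∈ Γ → ThreadStep A α a d t N → P α a d (N ∪ Γ \ {t}) → Pre A L P α a d Γ
  | spread {α : TreeType} {a : Alph} {d : D} {Γ : Set (Q × D)} {t : Q × D} {q₁ q₂ : Q} :
      t ∈ Γ → A.δ t.1 = .spread q₂ q₁ →
      (∀ s ∈ Γ \ {t}, (A.δ s.1).IsSpread ∨ (A.δ s.1).IsMoving) →
      P α a d (spreadSet q₂ q₁ (Γ \ {t}) ∪ Γ \ {t}) → Pre A L P α a d Γ
  | move {α : TreeType} {a : Alph} {d : D} {Γ : Set (Q × D)} :
      (∀ t ∈ Γ, (A.δ t.1).IsMoving) → (α.child = true ∨ α.sibling = true) →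
      (α.child = true → ∃ β, ∃ b ∈ L, ∃ e, P β b e (downSet A Γ)) →
      (α.sibling = true → ∃ β, ∃ b ∈ L, ∃ e, P β b e (rightSet A Γ)) → Pre A L P α a d Γ

/-- `Good A L n` holds of the node configurations from which all threads can be eliminated by runs
of height less than `n`. -/
def Good (A : Automaton Alph Q) (L : Set Alph) :
    ℕ → TreeType → Alph → D → Set (Q × D) → Prop
  | 0 => fun _ _ _ _ => False
  | n + 1 => Pre A L (Good A L n)

variable {A : Automaton Alph Q} {L : Set Alph}

theorem Pre.mono {P P' : TreeType → Alph → D → Set (Q × D) → Prop}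
    (h : ∀ α a d Γ, P α a d Γ → P' α a d Γ) {α : TreeType} {a : Alph} {d : D}
    {Γ : Set (Q × D)} (hp : Pre A L P α a d Γ) : Pre A L P' α a d Γ := by
  cases hp with
  | empty => exact .empty
  | thread h1 h2 h3 => exact .thread h1 h2 (h _ _ _ _ h3)
  | spread h1 h2 h3 h4 => exact .spread h1 h2 h3 (h _ _ _ _ h4)
  | move h1 h2 h3 h4 =>
    refine .move h1 h2 (fun hc => ?_) (fun hs => ?_)
    · obtain ⟨β, b, hb, e, hp⟩ := h3 hc
      exact ⟨β, b, hb, e, h _ _ _ _ hp⟩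
    · obtain ⟨β, b, hb, e, hp⟩ := h4 hs
      exact ⟨β, b, hb, e, h _ _ _ _ hp⟩

theorem Good.succ {n : ℕ} : ∀ {α : TreeType} {a : Alph} {d : D} {Γ : Set (Q × D)},
    Good A L n α a d Γ → Good A L (n + 1) α a d Γ := by
  induction n with
  | zero => intro _ _ _ _ h; exact h.elim
  | succ n ih => intro _ _ _ _ h; exact Pre.mono (fun _ _ _ _ h => ih h) h

theorem Good.mono {n m : ℕ} (hnm : n ≤ m) {α : TreeType} {a : Alph} {d : D} {Γ : Set (Q × D)}
    (h : Good A L n α a d Γ) : Good A L m α a d Γ := by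
  induction hnm with
  | refl => exact h
  | step _ ih => exact ih.succ

/-! ### Simulation up to renaming of letters, states and data -/

variable {Alph' : Type v₂} {Q' : Type w₂} {D' : Type u₂}

/-- Two instructions that agree up to a correspondence of letters and of states. -/
inductive InstrRel (RA : Alph' → Alph → Prop) (RQ : Q' → Q → Prop) :
    Instr Alph' Q' → Instr Alph Q → Prop
  | letter {a' a} : RA a' a → InstrRel RA RQ (.letter a') (.letter a)
  | notLetter {a' a} : RA a' a → InstrRel RA RQ (.notLetter a') (.notLetter a)
  | test {b} : InstrRel RA RQ (.test b) (.test b)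
  | store {q' q} : RQ q' q → InstrRel RA RQ (.store q') (.store q)
  | eq : InstrRel RA RQ .eq .eq
  | neq : InstrRel RA RQ .neq .neq
  | and {q' q p' p} : RQ q' q → RQ p' p → InstrRel RA RQ (.and q' p') (.and q p)
  | or {q' q p' p} : RQ q' q → RQ p' p → InstrRel RA RQ (.or q' p') (.or q p)
  | down {q' q} : RQ q' q → InstrRel RA RQ (.down q') (.down q)
  | right {q' q} : RQ q' q → InstrRel RA RQ (.right q') (.right q)
  | guess {q' q} : RQ q' q → InstrRel RA RQ (.guess q') (.guess q)
  | spread {q' q p' p} : RQ q' q → RQ p' p → InstrRel RA RQ (.spread q' p') (.spread q p)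

theorem InstrRel.isMoving {RA : Alph' → Alph → Prop} {RQ : Q' → Q → Prop} {i' : Instr Alph' Q'}
    {i : Instr Alph Q} (h : InstrRel RA RQ i' i) (hi : i.IsMoving) : i'.IsMoving := by
  rcases hi with ⟨q, rfl⟩ | ⟨q, rfl⟩
  · cases h; exact .inl ⟨_, rfl⟩
  · cases h; exact .inr ⟨_, rfl⟩

theorem InstrRel.isSpread {RA : Alph' → Alph → Prop} {RQ : Q' → Q → Prop} {i' : Instr Alph' Q'}
    {i : Instr Alph Q} (h : InstrRel RA RQ i' i) (hi : i.IsSpread) : i'.IsSpread := by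
  rcases hi with ⟨q, p, rfl⟩
  cases h; exact ⟨_, _, rfl⟩

/-- A relation that is the graph of a partial injection. -/
def BiUnique {X : Type*} {Y : Type*} (R : X → Y → Prop) : Prop :=
  ∀ ⦃x₁ y₁ x₂ y₂⦄, R x₁ y₁ → R x₂ y₂ → (x₁ = x₂ ↔ y₁ = y₂)

/-- The automaton `A'` with letters `L'` simulates `A` with letters `L` along a correspondence of
letters and states. -/
structure Corr (A' : Automaton Alph' Q') (A : Automaton Alph Q) (L' : Set Alph') (L : Set Alph)
    (RA : Alph' → Alph → Prop) (RQ : Q' → Q → Prop) : Prop where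
  letters_biUnique : BiUnique RA
  states_biUnique : BiUnique RQ
  instr : ∀ ⦃q' q⦄, RQ q' q → InstrRel RA RQ (A'.δ q') (A.δ q)
  letters : ∀ a ∈ L, ∃ a' ∈ L', RA a' a

theorem Corr.refl (A : Automaton Alph Q) (L : Set Alph) : Corr A A L L Eq Eq where
  letters_biUnique := by rintro _ _ _ _ rfl rfl; rfl
  states_biUnique := by rintro _ _ _ _ rfl rfl; rfl
  instr := by
    rintro q _ rfl
    cases A.δ q <;> constructor <;> rfl
  letters := fun a ha => ⟨a, ha, rfl⟩

/-- Every thread of `Γ'` corresponds to a thread of `Γ`. -/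
def Below (RQ : Q' → Q → Prop) (R : D' → D → Prop) (Γ' : Set (Q' × D')) (Γ : Set (Q × D)) :
    Prop :=
  ∀ t' ∈ Γ', ∃ t ∈ Γ, RQ t'.1 t.1 ∧ R t'.2 t.2

/-- A correspondence of finitely many data. -/
def FinPairs (R : D' → D → Prop) : Prop := {p : D' × D | R p.1 p.2}.Finite

/-- A finite relation leaves some element of the infinite `D'` unrelated to anything, and this
element can be paired with `e`. This is how the simulating side answers a guessed datum or the datum
of a new node. -/
theorem exists_extend [Infinite D'] {R : D' → D → Prop} (hf : FinPairs R) (hR : BiUnique R)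
    (e : D) : ∃ R' : D' → D → Prop, FinPairs R' ∧ BiUnique R' ∧ (∀ x y, R x y → R' x y) ∧
      ∃ e', R' e' e := by
  by_cases h : ∃ e', R e' e
  · exact ⟨R, hf, hR, fun _ _ h => h, h⟩
  obtain ⟨e', he'⟩ := (hf.image Prod.fst).exists_notMem
  have he'' : ∀ y, ¬ R e' y := fun y hy => he' ⟨(e', y), hy, rfl⟩
  refine ⟨fun x y => R x y ∨ (x = e' ∧ y = e), ?_, ?_, fun _ _ h => .inl h, e', .inr ⟨rfl, rfl⟩⟩
  · refine (hf.union (Set.finite_singleton (e', e))).subset ?_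
    rintro ⟨x, y⟩ (h | ⟨rfl, rfl⟩)
    · exact .inl h
    · exact .inr rfl
  · rintro x y x' y' (h1 | ⟨rfl, rfl⟩) (h2 | ⟨rfl, rfl⟩)
    · exact hR h1 h2
    · exact ⟨fun hx => (he'' y (hx ▸ h1)).elim, fun hy => (h ⟨x, hy ▸ h1⟩).elim⟩
    · exact ⟨fun hx => (he'' y' (hx ▸ h2)).elim, fun hy => (h ⟨x', hy ▸ h2⟩).elim⟩
    · simp

theorem Below.mono {RQ : Q' → Q → Prop} {R R' : D' → D → Prop} {Γ' : Set (Q' × D')}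
    {Γ : Set (Q × D)} (hR : ∀ x y, R x y → R' x y) (h : Below RQ R Γ' Γ) : Below RQ R' Γ' Γ :=
  fun t' ht' => let ⟨t, ht, h1, h2⟩ := h t' ht'; ⟨t, ht, h1, hR _ _ h2⟩

theorem Below.union {RQ : Q' → Q → Prop} {R : D' → D → Prop} {Γ' Δ' : Set (Q' × D')}
    {Γ Δ : Set (Q × D)} (h : Below RQ R Γ' Γ) (h' : Below RQ R Δ' Δ) :
    Below RQ R (Γ' ∪ Δ') (Γ ∪ Δ) := by
  rintro t' (ht' | ht')
  · obtain ⟨t, ht, h1⟩ := h t' ht'; exact ⟨t, .inl ht, h1⟩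
  · obtain ⟨t, ht, h1⟩ := h' t' ht'; exact ⟨t, .inr ht, h1⟩

/-- By bi-uniqueness `t'` is the only thread that can be matched with `t`, so the other threads keep
their partners when both are removed. -/
theorem Below.diff {RQ : Q' → Q → Prop} {R : D' → D → Prop} {Γ' : Set (Q' × D')}
    {Γ : Set (Q × D)} {t' : Q' × D'} {t : Q × D} (hQ : BiUnique RQ) (hR : BiUnique R)
    (h : Below RQ R Γ' Γ) (h1 : RQ t'.1 t.1) (h2 : R t'.2 t.2) :
    Below RQ R (Γ' \ {t'}) (Γ \ {t}) := by
  rintro s' ⟨hs', hne⟩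
  obtain ⟨s, hs, h3, h4⟩ := h s' hs'
  refine ⟨s, ⟨hs, fun hst => hne ?_⟩, h3, h4⟩
  rw [Set.mem_singleton_iff] at hst
  subst hst
  exact Prod.ext ((hQ h3 h1).2 rfl) ((hR h4 h2).2 rfl)

theorem below_singleton {RQ : Q' → Q → Prop} {R : D' → D → Prop} {t' : Q' × D'} {t : Q × D}
    (h1 : RQ t'.1 t.1) (h2 : R t'.2 t.2) : Below RQ R {t'} {t} := by
  rintro _ rfl; exact ⟨t, rfl, h1, h2⟩

theorem below_empty {RQ : Q' → Q → Prop} {R : D' → D → Prop} {Γ : Set (Q × D)} :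
    Below RQ R ∅ Γ := fun _ h => h.elim

variable {A' : Automaton Alph' Q'} {L' : Set Alph'} {RA : Alph' → Alph → Prop}
  {RQ : Q' → Q → Prop}

/-- Only `guess` needs a larger relation. The two (in)equality tests on data and the two on letters
transfer because the correspondences are injective in both directions. -/
theorem Corr.threadStep [Infinite D'] (C : Corr A' A L' L RA RQ) {R : D' → D → Prop}
    (hf : FinPairs R) (hR : BiUnique R) {α : TreeType} {a' : Alph'} {a : Alph} (ha : RA a' a)
    {d' : D'} {d : D} (hd : R d' d) {t' : Q' × D'} {t : Q × D} (h1 : RQ t'.1 t.1)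
    (h2 : R t'.2 t.2) {N : Set (Q × D)} (hN : ThreadStep A α a d t N) :
    ∃ R' : D' → D → Prop, FinPairs R' ∧ BiUnique R' ∧ (∀ x y, R x y → R' x y) ∧
      ∃ N', ThreadStep A' α a' d' t' N' ∧ Below RQ R' N' N := by
  obtain ⟨q', x'⟩ := t'
  have hI := C.instr h1
  have key : ∀ N', ThreadStep A' α a' d' (q', x') N' → Below RQ R N' N →
    ∃ R' : D' → D → Prop, FinPairs R' ∧ BiUnique R' ∧ (∀ x y, R x y → R' x y) ∧
      ∃ N', ThreadStep A' α a' d' (q', x') N' ∧ Below RQ R' N' N :=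
    fun N' h h' => ⟨R, hf, hR, fun _ _ h => h, N', h, h'⟩
  cases hN with
  | @or_left q q₁ q₂ x hδ =>
    simp only [hδ] at hI
    generalize hi : A'.δ q' = i at hI
    cases hI with | or h3 h4 => exact key _ (.or_left hi) (below_singleton h3 h2)
  | @or_right q q₁ q₂ x hδ =>
    simp only [hδ] at hI
    generalize hi : A'.δ q' = i at hI
    cases hI with | or h3 h4 => exact key _ (.or_right hi) (below_singleton h4 h2)
  | @and q q₁ q₂ x hδ =>
    simp only [hδ] at hI
    generalize hi : A'.δ q' = i at hI
    cases hI with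
    | and h3 h4 =>
      refine key _ (.and hi) ?_
      rintro t (rfl | rfl)
      · exact ⟨_, .inl rfl, h3, h2⟩
      · exact ⟨_, .inr rfl, h4, h2⟩
  | store hδ =>
    simp only [hδ] at hI
    generalize hi : A'.δ q' = i at hI
    cases hI with | store h3 => exact key _ (.store hi) (below_singleton h3 hd)
  | eq hδ h =>
    simp only [hδ] at hI
    generalize hi : A'.δ q' = i at hI
    cases hI with | eq => exact key _ (.eq hi ((hR hd h2).2 h)) below_empty
  | neq hδ h =>
    simp only [hδ] at hI
    generalize hi : A'.δ q' = i at hI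
    cases hI with | neq => exact key _ (.neq hi (mt (hR hd h2).1 h)) below_empty
  | test hδ h =>
    simp only [hδ] at hI
    generalize hi : A'.δ q' = i at hI
    cases hI with | test => exact key _ (.test hi h) below_empty
  | letter hδ h =>
    simp only [hδ] at hI
    generalize hi : A'.δ q' = i at hI
    cases hI with
    | letter h3 => exact key _ (.letter hi ((C.letters_biUnique h3 ha).2 h)) below_empty
  | notLetter hδ h =>
    simp only [hδ] at hI
    generalize hi : A'.δ q' = i at hI
    cases hI with
    | notLetter h3 => exact key _ (.notLetter hi (mt (C.letters_biUnique h3 ha).1 h)) below_empty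
  | guess e hδ =>
    simp only [hδ] at hI
    generalize hi : A'.δ q' = i at hI
    cases hI with
    | guess h3 =>
      obtain ⟨R', hf', hR', hsub, e', he'⟩ := exists_extend hf hR e
      exact ⟨R', hf', hR', hsub, _, .guess e' hi, below_singleton h3 he'⟩

theorem Corr.below_downSet (C : Corr A' A L' L RA RQ) {R : D' → D → Prop} {Γ' : Set (Q' × D')}
    {Γ : Set (Q × D)} (h : Below RQ R Γ' Γ) :
    Below RQ R (downSet A' Γ') (downSet A Γ) := by
  rintro ⟨p', x'⟩ ⟨q', hq', hδ'⟩
  obtain ⟨⟨q, x⟩, ht, h1, h2⟩ := h _ hq'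
  have hI := C.instr h1
  simp only at hδ'
  rw [hδ'] at hI
  generalize hi : A.δ (q, x).1 = i at hI
  cases hI with | down h3 => exact ⟨(_, x), ⟨q, ht, hi⟩, h3, h2⟩

theorem Corr.below_rightSet (C : Corr A' A L' L RA RQ) {R : D' → D → Prop} {Γ' : Set (Q' × D')}
    {Γ : Set (Q × D)} (h : Below RQ R Γ' Γ) :
    Below RQ R (rightSet A' Γ') (rightSet A Γ) := by
  rintro ⟨p', x'⟩ ⟨q', hq', hδ'⟩
  obtain ⟨⟨q, x⟩, ht, h1, h2⟩ := h _ hq'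
  have hI := C.instr h1
  simp only at hδ'
  rw [hδ'] at hI
  generalize hi : A.δ (q, x).1 = i at hI
  cases hI with | right h3 => exact ⟨(_, x), ⟨q, ht, hi⟩, h3, h2⟩

/-- Induction on the height, replaying the derivation on the smaller side. The correspondence of
data grows whenever the derivation introduces a datum. Taking `A' = A` gives monotonicity and
renaming; taking for one side a coded automaton gives independence of the data domain. -/
theorem Corr.good [Infinite D'] (C : Corr A' A L' L RA RQ) {n : ℕ} :
    ∀ {R : D' → D → Prop} {α : TreeType} {a' : Alph'} {a : Alph} {d' : D'} {d : D}
      {Γ' : Set (Q' × D')} {Γ : Set (Q × D)}, FinPairs R → BiUnique R → RA a' a → R d' d →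
      Below RQ R Γ' Γ → Good A L n α a d Γ → Good A' L' n α a' d' Γ' := by
  induction n with
  | zero => intro _ _ _ _ _ _ _ _ _ _ _ _ _ h; exact h.elim
  | succ n ih =>
    intro R α a' a d' d Γ' Γ hf hR ha hd hB hG
    cases hG with
    | empty =>
      have : Γ' = ∅ := Set.eq_empty_of_forall_notMem fun t ht => by
        obtain ⟨_, h, _⟩ := hB t ht; exact h
      subst this; exact .empty
    | @thread _ N t ht hN hP =>
      by_cases hex : ∃ t' ∈ Γ', RQ t'.1 t.1 ∧ R t'.2 t.2
      · obtain ⟨t', ht', h1, h2⟩ := hex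
        obtain ⟨R', hf', hR', hsub, N', hN', hB'⟩ := C.threadStep hf hR ha hd h1 h2 hN
        exact .thread ht' hN' (ih hf' hR' ha (hsub _ _ hd)
          (hB'.union ((hB.diff C.states_biUnique hR h1 h2).mono hsub)) hP)
      -- The rewritten thread has no counterpart, so the simulating side skips the step: `Γ'`
      -- already lies below the result, and one unit of height is left over.
      · refine Good.succ (ih hf hR ha hd (fun s' hs' => ?_) hP)
        obtain ⟨s, hs, h1, h2⟩ := hB s' hs'
        exact ⟨s, .inr ⟨hs, fun hst => hex ⟨s', hs', by
          rw [Set.mem_singleton_iff] at hst; subst hst; exact ⟨h1, h2⟩⟩⟩, h1, h2⟩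
    | @spread _ t q₁ q₂ ht hδ hall hP =>
      by_cases hex : ∃ t' ∈ Γ', RQ t'.1 t.1 ∧ R t'.2 t.2
      · obtain ⟨t', ht', h1, h2⟩ := hex
        have hI := C.instr h1
        rw [hδ] at hI
        generalize hi : A'.δ t'.1 = i at hI
        have hBd := hB.diff C.states_biUnique hR h1 h2
        cases hI with
        | @spread p₂ _ p₁ _ h3 h4 =>
          refine .spread ht' hi (fun s' hs' => ?_) (ih hf hR ha hd (Below.union ?_ hBd) hP)
          · obtain ⟨s, hs, h5, h6⟩ := hBd s' hs'
            exact (hall s hs).imp (C.instr h5).isSpread (C.instr h5).isMoving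
          · rintro ⟨_, x'⟩ ⟨rfl, hx'⟩
            obtain ⟨⟨q, x⟩, hs, h5, h6⟩ := hBd _ hx'
            -- Bi-uniqueness on states ensures that the copies made from `p₂` are matched by copies
            -- made from `q₂`.
            obtain rfl : q = q₂ := (C.states_biUnique h5 h3).1 rfl
            exact ⟨(q₁, x), ⟨rfl, hs⟩, h4, h6⟩
      · refine Good.succ (ih hf hR ha hd (fun s' hs' => ?_) hP)
        obtain ⟨s, hs, h1, h2⟩ := hB s' hs'
        exact ⟨s, .inr ⟨hs, fun hst => hex ⟨s', hs', by
          rw [Set.mem_singleton_iff] at hst; subst hst; exact ⟨h1, h2⟩⟩⟩, h1, h2⟩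
    | move hm hα hc hs =>
      refine .move (fun t' ht' => ?_) hα (fun h => ?_) (fun h => ?_)
      · obtain ⟨t, ht, h1, h2⟩ := hB t' ht'
        exact (C.instr h1).isMoving (hm t ht)
      · obtain ⟨β, b, hb, e, hP⟩ := hc h
        obtain ⟨b', hb', hbb⟩ := C.letters b hb
        obtain ⟨R', hf', hR', hsub, e', he'⟩ := exists_extend hf hR e
        exact ⟨β, b', hb', e', ih hf' hR' hbb he' ((C.below_downSet hB).mono hsub) hP⟩
      · obtain ⟨β, b, hb, e, hP⟩ := hs h
        obtain ⟨b', hb', hbb⟩ := C.letters b hb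
        obtain ⟨R', hf', hR', hsub, e', he'⟩ := exists_extend hf hR e
        exact ⟨β, b', hb', e', ih hf' hR' hbb he' ((C.below_rightSet hB).mono hsub) hP⟩

/-- Having fewer threads makes it easier to eliminate them. -/
theorem Good.anti [Infinite D] {n : ℕ} {α : TreeType} {a : Alph} {d : D} {Γ Γ' : Set (Q × D)}
    (hfin : Γ.Finite) (hsub : Γ' ⊆ Γ) (h : Good A L n α a d Γ) : Good A L n α a d Γ' := by
  let S : Set D := insert d (Prod.snd '' Γ)
  -- Equality is cut down to the finitely many data that occur, since the correspondence of data has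
  -- to be finite.
  refine (Corr.refl A L).good (R := fun x y => x = y ∧ x ∈ S) ?_ ?_ rfl ⟨rfl, .inl rfl⟩ ?_ h
  · refine (((hfin.image Prod.snd).insert d).image fun x => (x, x)).subset ?_
    rintro ⟨x, y⟩ ⟨hxy, hx⟩
    exact ⟨x, hx, Prod.ext rfl hxy⟩
  · rintro _ _ _ _ ⟨rfl, _⟩ ⟨rfl, _⟩; rfl
  · exact fun t ht => ⟨t, hsub ht, rfl, rfl, .inr ⟨t, hsub ht, rfl⟩⟩

/-- Renaming of data. -/
theorem Good.rename [Infinite D'] {n : ℕ} {α : TreeType} {a : Alph} {d : D} {Γ : Set (Q × D)}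
    {Γ' : Set (Q × D')} (f : D' → D) {d' : D'} (hfin : Γ'.Finite) (hd : f d' = d)
    (hinj : Set.InjOn f (insert d' (Prod.snd '' Γ'))) (hΓ : ∀ t ∈ Γ', (t.1, f t.2) ∈ Γ)
    (h : Good A L n α a d Γ) : Good A L n α a d' Γ' := by
  let S : Set D' := insert d' (Prod.snd '' Γ')
  refine (Corr.refl A L).good (R := fun x y => f x = y ∧ x ∈ S) ?_ ?_ rfl ⟨hd, .inl rfl⟩ ?_ h
  · refine (((hfin.image Prod.snd).insert d').image fun x => (x, f x)).subset ?_
    rintro ⟨x, y⟩ ⟨hxy, hx⟩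
    exact ⟨x, hx, Prod.ext rfl hxy⟩
  · rintro x _ y _ ⟨rfl, hx⟩ ⟨rfl, hy⟩
    exact ⟨fun h => h ▸ rfl, fun h => hinj hx hy h⟩
  · exact fun t ht => ⟨(t.1, f t.2), hΓ t ht, rfl, rfl, .inr ⟨t, ht, rfl⟩⟩

end Winning

end ATRA

namespace ATRA

/-! ### Runs and winning configurations -/

section Runs

variable {Alph : Type v} {Q : Type w} {D : Type u} {A : Automaton Alph Q}

/-- The threads of the node configuration can be eliminated. -/
def NodeConf.Winning (A : Automaton Alph Q) (ρ : NodeConf Alph Q D) : Prop :=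
  ∃ n, Good A Set.univ n ρ.type ρ.letter ρ.datum (ρ.threads : Set (Q × D))

theorem diff_subset_of_eq_union {X : Type*} {Γ Δ : Set X} {t : X} (h : Γ = {t} ∪ Δ) :
    Γ \ {t} ⊆ Δ := by
  subst h
  rintro s ⟨hs | hs, hne⟩
  · exact (hne hs).elim
  · exact hs

/-- In a run the remaining set `Δ` may still contain the rewritten thread, whereas `Pre` always
removes it. The difference is harmless because winning survives the loss of threads. -/
theorem EpsStep.winning [Infinite D] {ρ τ : NodeConf Alph Q D} (h : EpsStep A ρ τ)
    (hτ : τ.Winning A) : ρ.Winning A := by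
  obtain ⟨n, hn⟩ := hτ
  cases h with
  | @thread x α a d Γ Γ' Δ t N h1 h2 h3 =>
    refine ⟨n + 1, .thread (t := t) (N := N) ?_ h2 (Good.anti Γ'.finite_toSet ?_ hn)⟩
    · simp only [h1]; exact .inl rfl
    · simp only [h3]
      exact Set.union_subset_union_right _ (diff_subset_of_eq_union h1)
  | @spread x α a d Γ Γ' Δ q q₁ q₂ d' h1 h2 h3 h4 =>
    have hsub := diff_subset_of_eq_union h1
    refine ⟨n + 1, .spread (t := (q, d')) ?_ h2 (fun s hs => h3 s (hsub hs))
      (Good.anti Γ'.finite_toSet ?_ hn)⟩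
    · simp only [h1]; exact .inl rfl
    · simp only [h4]
      exact Set.union_subset_union (fun s hs => ⟨hs.1, hsub hs.2⟩) hsub

theorem TreeStep.winning [Infinite D] {S₁ S₂ : TreeConf Alph Q D} (h : TreeStep A S₁ S₂)
    (h₂ : ∀ ρ ∈ S₂, ρ.Winning A) : ∀ ρ ∈ S₁, ρ.Winning A := by
  have key : ∀ {S : TreeConf Alph Q D} {ρ : NodeConf Alph Q D},
      (S₁ : Set (NodeConf Alph Q D)) = {ρ} ∪ ↑S → (∀ σ ∈ S, σ ∈ S₂) → ρ.Winning A →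
      ∀ ρ ∈ S₁, ρ.Winning A := by
    intro S ρ h hS hρ σ hσ
    rw [← Finset.mem_coe, h] at hσ
    rcases hσ with rfl | hσ
    · exact hρ
    · exact h₂ σ (hS σ hσ)
  cases h with
  | @eps S ρ τ h h' hst =>
    refine key h (fun σ hσ => ?_) (hst.winning (h₂ τ ?_))
    · rw [← Finset.mem_coe, h']; exact .inr hσ
    · rw [← Finset.mem_coe, h']; exact .inl rfl
  | @child S ρ τ h h' hα hst =>
    refine key h (fun σ hσ => ?_) ?_
    · rw [← Finset.mem_coe, h']; exact .inr hσ
    · obtain ⟨n, hn⟩ := h₂ τ (by rw [← Finset.mem_coe, h']; exact .inl rfl)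
      rw [hst.2.2.2] at hn
      exact ⟨n + 1, .move hst.2.2.1 (.inl hst.1) (fun _ => ⟨_, _, trivial, _, hn⟩)
        (fun hs => by simp [hα] at hs)⟩
  | @sibling S ρ τ h h' hα hst =>
    refine key h (fun σ hσ => ?_) ?_
    · rw [← Finset.mem_coe, h']; exact .inr hσ
    · obtain ⟨n, hn⟩ := h₂ τ (by rw [← Finset.mem_coe, h']; exact .inl rfl)
      rw [hst.2.2.2] at hn
      exact ⟨n + 1, .move hst.2.2.1 (.inr hst.1) (fun hs => by simp [hα] at hs)
        (fun _ => ⟨_, _, trivial, _, hn⟩)⟩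
  | @both S ρ τ₁ τ₂ h h' hα hst₁ hst₂ =>
    refine key h (fun σ hσ => ?_) ?_
    · rw [← Finset.mem_coe, h']; exact .inr hσ
    · obtain ⟨n, hn⟩ := h₂ τ₁ (by rw [← Finset.mem_coe, h']; exact .inl (.inl rfl))
      obtain ⟨m, hm⟩ := h₂ τ₂ (by rw [← Finset.mem_coe, h']; exact .inl (.inr rfl))
      rw [hst₁.2.2.2] at hn
      rw [hst₂.2.2.2] at hm
      exact ⟨max n m + 1, .move hst₁.2.2.1 (.inl hst₁.1)
        (fun _ => ⟨_, _, trivial, _, hn.mono (le_max_left n m)⟩)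
        (fun _ => ⟨_, _, trivial, _, hm.mono (le_max_right n m)⟩)⟩

/-- Winning is propagated backwards along the run from the last tree configuration, which has no
threads. The type of the root has no sibling because `[]` is not of the form `x ++ [i]`. -/
theorem exists_good_of_mem_language [Infinite D] {T : DataTree Alph D} (hT : T ∈ A.language D) :
    ∃ n c a, ∃ d : D, Good A Set.univ n ⟨c, false⟩ a d {(A.init, d)} := by
  obtain ⟨n, S, ⟨⟨α, a, d, h0⟩, hstep, hover⟩, hlast⟩ := hT
  have hall : ∀ i, ∀ ρ ∈ S i, ρ.Winning A := by
    intro i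
    induction i using Fin.reverseInduction with
    | last =>
      intro ρ hρ
      refine ⟨1, ?_⟩
      rw [hlast ρ hρ, Finset.coe_empty]
      exact .empty
    | cast i ih => exact (hstep i).winning ih
  have hmem : (⟨[], α, a, d, {(A.init, d)}⟩ : NodeConf Alph Q D) ∈ S 0 := by simp [h0]
  obtain ⟨m, hm⟩ := hall 0 _ hmem
  have hs : α.sibling = false := by
    have := (hover 0 _ hmem).2.2
    rw [← Bool.not_eq_true, this]
    rintro ⟨x', i, h, _⟩
    simp at h
  obtain ⟨c, s⟩ := α
  obtain rfl : s = false := hs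
  exact ⟨m, c, a, d, by simpa using hm⟩

end Runs

/-! ### Building data trees -/

/-- Ordered forests, in first-child next-sibling form. -/
inductive Forest (X : Type u)
  | nil
  | cons (l : X) (c s : Forest X)

namespace Forest

variable {X : Type u}

def isCons : Forest X → Bool
  | nil => false
  | cons _ _ _ => true

/-- The label at a position of a forest, the roots having the positions `[0], [1], …`. -/
def look : Forest X → List ℕ → Option X
  | nil, _ => none
  | cons _ _ _, [] => none
  | cons l _ _, [0] => some l
  | cons _ c _, 0 :: j :: y => c.look (j :: y)
  | cons _ _ s, (i + 1) :: y => s.look (i :: y)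

theorem isSome_look_zero (F : Forest X) : (F.look [0]).isSome = F.isCons := by
  cases F <;> rfl

theorem finite_support (F : Forest X) : {x | (F.look x).isSome = true}.Finite := by
  induction F with
  | nil => simp [look]
  | cons l c s hc hs =>
    refine (((Set.finite_singleton [0]).union (hc.image (List.cons 0))).union
      (hs.image fun x => (x.headI + 1) :: x.tail)).subset ?_
    intro x hx
    match x, hx with
    | [], hx => simp [look] at hx
    | [0], _ => exact .inl (.inl rfl)
    | 0 :: j :: y, hx => exact .inl (.inr ⟨j :: y, hx, rfl⟩)
    | (i + 1) :: y, hx => exact .inr ⟨i :: y, hx, rfl⟩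

theorem isSome_look_append (F : Forest X) : ∀ i x y, (F.look (i :: (x ++ y))).isSome = true →
    (F.look (i :: x)).isSome = true := by
  induction F with
  | nil => intro i x y h; simp [look] at h
  | cons l c s hc hs =>
    intro i x y h
    match i, x, h with
    | 0, [], _ => rfl
    | 0, j :: x, h => exact hc j x y h
    | i + 1, x, h => exact hs i x y h

theorem isSome_look_sibling (F : Forest X) : ∀ x i, (F.look (x ++ [i + 1])).isSome = true →
    (F.look (x ++ [i])).isSome = true := by
  induction F with
  | nil => intro x i h; simp [look] at h
  | cons l c s hc hs =>
    intro x i h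
    match x, i, h with
    | [], 0, _ => rfl
    | [], i + 1, h => exact hs [] i h
    | [0], i, h => exact hc [] i h
    | 0 :: j :: x, i, h => exact hc (j :: x) i h
    | (j + 1) :: x, i, h => exact hs (j :: x) i h

/-- The tree with root label `l` and the trees of `c` below the root. -/
noncomputable def toTree {Alph : Type v} {D : Type w} (l : Alph × D) (c : Forest (Alph × D)) :
    DataTree Alph D where
  pos := Set.Finite.toFinset (s := {x | ((cons l c nil).look (0 :: x)).isSome = true})
    ((finite_support (cons l c nil)).preimage (List.cons_injective.injOn))
  root_mem := by simp [look]
  prefix_closed := by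
    intro x y h
    simp only [Set.Finite.mem_toFinset, Set.mem_ofPred_eq] at h ⊢
    exact isSome_look_append _ _ _ _ h
  sibling_closed := by
    intro x i h
    simp only [Set.Finite.mem_toFinset, Set.mem_ofPred_eq] at h ⊢
    exact isSome_look_sibling _ (0 :: x) i h
  label x := ((cons l c nil).look (0 :: x.1)).get (by
    have := x.2
    simpa only [Set.Finite.mem_toFinset, Set.mem_ofPred_eq] using this)

end Forest

/-! ### From derivations to trees with accepting runs -/

section Build

variable {Alph : Type v} {Q : Type w} {D : Type u}

open Classical in
/-- The label at a position, if it is a position of the tree. -/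
noncomputable def DataTree.look (T : DataTree Alph D) (x : List ℕ) : Option (Alph × D) :=
  if h : x ∈ T.pos then some (T.label ⟨x, h⟩) else none

theorem DataTree.isSome_look (T : DataTree Alph D) (x : List ℕ) :
    (T.look x).isSome = true ↔ x ∈ T.pos := by
  unfold DataTree.look
  split_ifs with h <;> simp [h]

theorem Forest.look_toTree (l : Alph × D) (c : Forest (Alph × D)) (x : List ℕ) :
    (Forest.toTree l c).look x = (Forest.cons l c .nil).look (0 :: x) := by
  unfold DataTree.look
  split_ifs with h
  · simp [Forest.toTree]
  · simp only [Forest.toTree, Set.Finite.mem_toFinset, Set.mem_ofPred_eq] at h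
    rw [Option.not_isSome_iff_eq_none] at h
    exact h.symm

/-- At position `p`, the tree `T` has the label `l`, the forest `c` below `p`, and the forest `s`
to the right of `p`. -/
structure At (T : DataTree Alph D) (p : List ℕ) (l : Alph × D) (c s : Forest (Alph × D)) :
    Prop where
  label : T.look p = some l
  below : ∀ j y, T.look (p ++ j :: y) = c.look (j :: y)
  right : ∀ x i, p = x ++ [i] → ∀ j y, T.look (x ++ (i + 1 + j) :: y) = s.look (j :: y)
  not_root : s.isCons = true → ∃ x i, p = x ++ [i]

theorem At.child {T : DataTree Alph D} {p : List ℕ} {l l' : Alph × D}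
    {c' s' s : Forest (Alph × D)} (h : At T p l (.cons l' c' s') s) :
    At T (p ++ [0]) l' c' s' where
  label := by rw [h.below]; rfl
  below j y := by rw [List.append_assoc, List.singleton_append, h.below]; rfl
  right x i hx j y := by
    obtain ⟨rfl, hi⟩ := List.append_inj' hx rfl
    obtain rfl : 0 = i := by simpa using hi
    rw [h.below, show 0 + 1 + j = j + 1 by omega]; rfl
  not_root _ := ⟨p, 0, rfl⟩

theorem At.sibling {T : DataTree Alph D} {x : List ℕ} {i : ℕ} {l l' : Alph × D}
    {c' s' c : Forest (Alph × D)} (h : At T (x ++ [i]) l c (.cons l' c' s')) :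
    At T (x ++ [i + 1]) l' c' s' where
  label := by
    have := h.right x i rfl 0 []
    exact this
  below j y := by
    have := h.right x i rfl 0 (j :: y)
    rw [List.append_assoc, List.singleton_append]
    exact this
  right x' i' hx j y := by
    obtain ⟨rfl, hi⟩ := List.append_inj' hx rfl
    obtain rfl : i + 1 = i' := by simpa using hi
    rw [show i + 1 + 1 + j = i + 1 + (j + 1) by omega, h.right x i rfl]; rfl
  not_root _ := ⟨x, i + 1, rfl⟩

theorem At.isOver {T : DataTree Alph D} {p : List ℕ} {a : Alph} {d : D}
    {c s : Forest (Alph × D)} (h : At T p (a, d) c s) {α : TreeType} (hc : c.isCons = α.child)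
    (hs : s.isCons = α.sibling) (Γ : Finset (Q × D)) :
    (⟨p, α, a, d, Γ⟩ : NodeConf Alph Q D).IsOver T := by
  have hl := h.label
  refine ⟨?_, ?_, ?_⟩
  · unfold DataTree.look at hl
    split_ifs at hl with hp
    exact ⟨hp, (Option.some.inj hl).symm⟩
  · rw [← T.isSome_look, h.below, Forest.isSome_look_zero, hc]
  · simp only
    rw [← hs]
    constructor
    · intro h1
      obtain ⟨x, i, rfl⟩ := h.not_root h1
      refine ⟨x, i, rfl, ?_⟩
      have := h.right x i rfl 0 []
      rw [← T.isSome_look]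
      simp only [add_zero] at this
      rw [this, Forest.isSome_look_zero, h1]
    · rintro ⟨x, i, rfl, h1⟩
      have := h.right x i rfl 0 []
      rw [← T.isSome_look] at h1
      simp only [add_zero] at this
      rw [this, Forest.isSome_look_zero] at h1
      exact h1

/-- A step between tree configurations over `T`. -/
def StepOver (A : Automaton Alph Q) (T : DataTree Alph D) (S S' : TreeConf Alph Q D) : Prop :=
  TreeStep A S S' ∧ ∀ ρ ∈ S', ρ.IsOver T

/-- All threads of `S` can be eliminated over `T`. -/
def Clears (A : Automaton Alph Q) (T : DataTree Alph D) (S : TreeConf Alph Q D) : Prop :=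
  (∀ ρ ∈ S, ρ.IsOver T) ∧
    ∃ S', Relation.ReflTransGen (StepOver A T) S S' ∧ ∀ ρ ∈ S', ρ.threads = ∅

variable {A : Automaton Alph Q} {T : DataTree Alph D}

-- The context of a step may contain the rewritten configuration itself, so adding further
-- configurations needs no disjointness.
open Classical in
theorem TreeStep.frame {S₁ S₂ : TreeConf Alph Q D} (h : TreeStep A S₁ S₂)
    (S : TreeConf Alph Q D) : TreeStep A (S₁ ∪ S) (S₂ ∪ S) := by
  cases h with
  | @eps U ρ τ h h' hst =>
    refine .eps (S := U ∪ S) ?_ ?_ hst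
    · rw [Finset.coe_union, h, Finset.coe_union, Set.union_assoc]
    · rw [Finset.coe_union, h', Finset.coe_union, Set.union_assoc]
  | @child U ρ τ h h' hα hst =>
    refine .child (S := U ∪ S) ?_ ?_ hα hst
    · rw [Finset.coe_union, h, Finset.coe_union, Set.union_assoc]
    · rw [Finset.coe_union, h', Finset.coe_union, Set.union_assoc]
  | @sibling U ρ τ h h' hα hst =>
    refine .sibling (S := U ∪ S) ?_ ?_ hα hst
    · rw [Finset.coe_union, h, Finset.coe_union, Set.union_assoc]
    · rw [Finset.coe_union, h', Finset.coe_union, Set.union_assoc]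
  | @both U ρ τ₁ τ₂ h h' hα hst hst' =>
    refine .both (S := U ∪ S) ?_ ?_ hα hst hst'
    · rw [Finset.coe_union, h, Finset.coe_union, Set.union_assoc]
    · rw [Finset.coe_union, h', Finset.coe_union, Set.union_assoc]

open Classical in
theorem reach_frame {S₁ S₂ : TreeConf Alph Q D}
    (h : Relation.ReflTransGen (StepOver A T) S₁ S₂) {S : TreeConf Alph Q D}
    (hS : ∀ ρ ∈ S, ρ.IsOver T) : Relation.ReflTransGen (StepOver A T) (S₁ ∪ S) (S₂ ∪ S) := by
  induction h with
  | refl => exact .refl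
  | tail _ hst ih =>
    refine ih.tail ⟨hst.1.frame S, fun ρ hρ => ?_⟩
    rcases Finset.mem_union.1 hρ with hρ | hρ
    · exact hst.2 ρ hρ
    · exact hS ρ hρ

-- The threads of `S₁` are eliminated while `S₂` waits, then those of `S₂` while the final part of
-- the first run waits.
open Classical in
theorem Clears.union {S₁ S₂ : TreeConf Alph Q D} (h₁ : Clears A T S₁) (h₂ : Clears A T S₂) :
    Clears A T (S₁ ∪ S₂) := by
  obtain ⟨ho₁, U₁, hr₁, he₁⟩ := h₁
  obtain ⟨ho₂, U₂, hr₂, he₂⟩ := h₂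
  have hU₁ : ∀ ρ ∈ U₁, ρ.IsOver T := by
    rcases hr₁.cases_tail with rfl | ⟨_, _, h⟩
    · exact ho₁
    · exact h.2
  refine ⟨fun ρ hρ => (Finset.mem_union.1 hρ).elim (ho₁ ρ) (ho₂ ρ), U₁ ∪ U₂, ?_,
    fun ρ hρ => (Finset.mem_union.1 hρ).elim (he₁ ρ) (he₂ ρ)⟩
  refine (reach_frame hr₁ ho₂).trans ?_
  rw [Finset.union_comm U₁, Finset.union_comm U₁]
  exact reach_frame hr₂ hU₁

theorem Clears.of_step {S₁ S₂ : TreeConf Alph Q D} (ho : ∀ ρ ∈ S₁, ρ.IsOver T)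
    (hst : TreeStep A S₁ S₂) (h : Clears A T S₂) : Clears A T S₁ := by
  obtain ⟨ho₂, U, hr, he⟩ := h
  exact ⟨ho, U, hr.head ⟨hst, ho₂⟩, he⟩

theorem ThreadStep.finite {α : TreeType} {a : Alph} {d : D} {t : Q × D} {N : Set (Q × D)}
    (h : ThreadStep A α a d t N) : N.Finite := by
  cases h <;> simp

theorem finite_spreadSet {Γ : Set (Q × D)} (h : Γ.Finite) (q₂ q₁ : Q) :
    (spreadSet q₂ q₁ Γ).Finite := by
  refine (h.image fun t => (q₁, t.2)).subset ?_
  rintro ⟨_, x⟩ ⟨rfl, hx⟩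
  exact ⟨_, hx, rfl⟩

theorem finite_downSet {Γ : Set (Q × D)} (h : Γ.Finite) : (downSet A Γ).Finite := by
  refine (h.biUnion (t := fun s => {t | t.2 = s.2 ∧ A.δ s.1 = .down t.1}) fun s _ => ?_).subset ?_
  · refine Set.Subsingleton.finite ?_
    rintro ⟨p, x⟩ ⟨hx, hp⟩ ⟨p', x'⟩ ⟨hx', hp'⟩
    simp only at hx hp hx' hp'
    rw [hp] at hp'
    cases hp'
    rw [hx, hx']
  · rintro ⟨p, x⟩ ⟨q, hq, hδ⟩
    exact Set.mem_biUnion hq ⟨rfl, hδ⟩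

theorem finite_rightSet {Γ : Set (Q × D)} (h : Γ.Finite) : (rightSet A Γ).Finite := by
  refine (h.biUnion (t := fun s => {t | t.2 = s.2 ∧ A.δ s.1 = .right t.1}) fun s _ => ?_).subset ?_
  · refine Set.Subsingleton.finite ?_
    rintro ⟨p, x⟩ ⟨hx, hp⟩ ⟨p', x'⟩ ⟨hx', hp'⟩
    simp only at hx hp hx' hp'
    rw [hp] at hp'
    cases hp'
    rw [hx, hx']
  · rintro ⟨p, x⟩ ⟨q, hq, hδ⟩
    exact Set.mem_biUnion hq ⟨rfl, hδ⟩

theorem TreeStep.of_eps {ρ τ : NodeConf Alph Q D} (h : EpsStep A ρ τ) :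
    TreeStep A {ρ} {τ} := .eps (S := ∅) (by simp) (by simp) h

theorem TreeStep.of_child {ρ τ : NodeConf Alph Q D} (hα : ρ.type = ⟨true, false⟩)
    (h : ChildStep A ρ τ) : TreeStep A {ρ} {τ} := .child (S := ∅) (by simp) (by simp) hα h

theorem TreeStep.of_sibling {ρ τ : NodeConf Alph Q D} (hα : ρ.type = ⟨false, true⟩)
    (h : SiblingStep A ρ τ) : TreeStep A {ρ} {τ} := .sibling (S := ∅) (by simp) (by simp) hα h

open Classical in
theorem TreeStep.of_both {ρ τ₁ τ₂ : NodeConf Alph Q D} (hα : ρ.type = ⟨true, true⟩)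
    (h₁ : ChildStep A ρ τ₁) (h₂ : SiblingStep A ρ τ₂) : TreeStep A {ρ} ({τ₁} ∪ {τ₂}) := by
  refine .both (S := ∅) (by simp) ?_ hα h₁ h₂
  ext
  simp

/-- The forests below and to the right are read off the derivation from its end. The surrounding
tree and the position are not yet known at that moment, hence the quantification over all `T` and
`p` that contain these forests in the right place. -/
theorem Good.exists_forest {L : Set Alph} {n : ℕ} : ∀ {α : TreeType} {a : Alph} {d : D}
    {Γ : Set (Q × D)} (_ : Γ.Finite), Good A L n α a d Γ →
    ∃ c s : Forest (Alph × D), c.isCons = α.child ∧ s.isCons = α.sibling ∧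
      ∀ (T : DataTree Alph D) (p : List ℕ) (Δ : Finset (Q × D)), (Δ : Set (Q × D)) = Γ →
        At T p (a, d) c s → Clears A T {⟨p, α, a, d, Δ⟩} := by
  classical
  induction n with
  | zero => intro _ _ _ _ _ h; exact h.elim
  | succ n ih =>
    intro α a d Γ hfin hG
    cases hG with
    | empty =>
      -- No thread is left, but the type may still promise a child or a sibling; an arbitrary single
      -- node fulfils the promise.
      have hF : ∀ b : Bool, ∃ F : Forest (Alph × D), F.isCons = b
        | true => ⟨.cons (a, d) .nil .nil, rfl⟩
        | false => ⟨.nil, rfl⟩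
      obtain ⟨c, hc⟩ := hF α.child
      obtain ⟨s, hs⟩ := hF α.sibling
      refine ⟨c, s, hc, hs, fun T p Δ hΔ hat => ?_⟩
      obtain rfl : Δ = ∅ := by simpa using hΔ
      exact ⟨by simpa using hat.isOver hc hs ∅, _, .refl, by simp⟩
    | @thread _ N t ht hN hP =>
      have hfin' : (N ∪ Γ \ {t}).Finite := hN.finite.union (hfin.subset Set.sdiff_subset)
      obtain ⟨c, s, hc, hs, hcl⟩ := ih hfin' hP
      refine ⟨c, s, hc, hs, fun T p Δ hΔ hat => ?_⟩
      refine .of_step (by simpa using hat.isOver hc hs Δ) (.of_eps (.thread (t := t) (N := N)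
        (Γ' := hfin'.toFinset) (Δ := Δ.erase t) ?_ hN ?_)) (hcl T p _ (by simp) hat)
      · rw [Finset.coe_erase, hΔ, Set.singleton_union, Set.insert_sdiff_singleton,
          Set.insert_eq_of_mem ht]
      · rw [Set.Finite.coe_toFinset, Finset.coe_erase, hΔ]
    | @spread _ t q₁ q₂ ht hδ hall hP =>
      have hfd : (Γ \ {t}).Finite := hfin.subset Set.sdiff_subset
      have hfin' := (finite_spreadSet hfd q₂ q₁).union hfd
      obtain ⟨c, s, hc, hs, hcl⟩ := ih hfin' hP
      refine ⟨c, s, hc, hs, fun T p Δ hΔ hat => ?_⟩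
      have he : ((Δ.erase t : Finset (Q × D)) : Set (Q × D)) = Γ \ {t} := by
        rw [Finset.coe_erase, hΔ]
      refine .of_step (by simpa using hat.isOver hc hs Δ) (.of_eps (.spread (q := t.1) (d' := t.2)
        (Γ' := hfin'.toFinset) (Δ := Δ.erase t) (q₁ := q₁) (q₂ := q₂) ?_ hδ ?_ ?_))
        (hcl T p _ (by simp) hat)
      · rw [he, hΔ, Set.singleton_union, Set.insert_sdiff_singleton,
          Set.insert_eq_of_mem ht]
      · intro s hs
        exact hall s (by rw [← he]; exact hs)
      · rw [Set.Finite.coe_toFinset, he]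
        congr 1
        ext s
        rw [spreadSet, Set.mem_ofPred_eq, Set.mem_ofPred_eq, ← he, Finset.mem_coe]
    | move hm hα hcs hss =>
      have hdown : ∃ c : Forest (Alph × D), c.isCons = α.child ∧ (α.child = true →
          ∃ β b e, ∀ (T : DataTree Alph D) (p : List ℕ) (s : Forest (Alph × D)),
            At T p (a, d) c s →
            Clears A T {⟨p ++ [0], β, b, e, (finite_downSet (A := A) hfin).toFinset⟩}) := by
        cases hb : α.child with
        | false => exact ⟨.nil, rfl, fun h => by simp at h⟩
        | true =>
          obtain ⟨β, b, hb, e, hP⟩ := hcs hb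
          obtain ⟨c', s', hc', hs', hcl⟩ := ih (finite_downSet hfin) hP
          exact ⟨.cons (b, e) c' s', rfl, fun _ => ⟨β, b, e, fun T p s hat =>
            hcl T _ _ (by simp) hat.child⟩⟩
      have hright : ∃ s : Forest (Alph × D), s.isCons = α.sibling ∧ (α.sibling = true →
          ∃ β b e, ∀ (T : DataTree Alph D) (x : List ℕ) (i : ℕ) (c : Forest (Alph × D)),
            At T (x ++ [i]) (a, d) c s →
            Clears A T {⟨x ++ [i + 1], β, b, e, (finite_rightSet (A := A) hfin).toFinset⟩}) := by
        cases hb : α.sibling with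
        | false => exact ⟨.nil, rfl, fun h => by simp at h⟩
        | true =>
          obtain ⟨β, b, hb, e, hP⟩ := hss hb
          obtain ⟨c', s', hc', hs', hcl⟩ := ih (finite_rightSet hfin) hP
          exact ⟨.cons (b, e) c' s', rfl, fun _ => ⟨β, b, e, fun T p i s hat =>
            hcl T _ _ (by simp) hat.sibling⟩⟩
      obtain ⟨c, hc, hc'⟩ := hdown
      obtain ⟨s, hs, hs'⟩ := hright
      refine ⟨c, s, hc, hs, fun T p Δ hΔ hat => ?_⟩
      have hmv : (⟨p, α, a, d, Δ⟩ : NodeConf Alph Q D).IsMoving A :=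
        fun t ht => hm t (by rw [← hΔ]; exact ht)
      have hd : ((finite_downSet (A := A) hfin).toFinset : Set (Q × D)) =
          {t | ∃ q, (q, t.2) ∈ Δ ∧ A.δ q = .down t.1} := by
        rw [Set.Finite.coe_toFinset]
        subst hΔ; rfl
      have hr : ((finite_rightSet (A := A) hfin).toFinset : Set (Q × D)) =
          {t | ∃ q, (q, t.2) ∈ Δ ∧ A.δ q = .right t.1} := by
        rw [Set.Finite.coe_toFinset]
        subst hΔ; rfl
      have ho : ∀ ρ ∈ ({⟨p, α, a, d, Δ⟩} : TreeConf Alph Q D), ρ.IsOver T := by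
        simpa using hat.isOver hc hs Δ
      obtain ⟨_ | _, _ | _⟩ := α
      · simp at hα
      · obtain ⟨β, b, e, h1⟩ := hs' rfl
        obtain ⟨x, i, rfl⟩ := hat.not_root hs
        refine .of_step ho ?_ (h1 T x i c hat)
        exact .of_sibling rfl ⟨rfl, ⟨x, i, rfl, rfl⟩, hmv, hr⟩
      · obtain ⟨β, b, e, h1⟩ := hc' rfl
        refine .of_step ho ?_ (h1 T p s hat)
        exact .of_child rfl ⟨rfl, rfl, hmv, hd⟩
      · obtain ⟨β₁, b₁, e₁, h1⟩ := hc' rfl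
        obtain ⟨β₂, b₂, e₂, h2⟩ := hs' rfl
        obtain ⟨x, i, rfl⟩ := hat.not_root hs
        refine .of_step ho ?_ ((h1 T _ s hat).union (h2 T x i c hat))
        exact .of_both rfl ⟨rfl, rfl, hmv, hd⟩ ⟨rfl, ⟨x, i, rfl, rfl⟩, hmv, hr⟩

theorem exists_seq_of_reflTransGen {X : Type*} {r : X → X → Prop} {x y : X}
    (h : Relation.ReflTransGen r x y) : ∃ (n : ℕ) (S : Fin (n + 1) → X),
      S 0 = x ∧ S (Fin.last n) = y ∧ ∀ i : Fin n, r (S i.castSucc) (S i.succ) := by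
  induction h using Relation.ReflTransGen.head_induction_on with
  | refl => exact ⟨0, fun _ => y, rfl, rfl, fun i => i.elim0⟩
  | @head x z hxz _ ih =>
    obtain ⟨n, S, h0, hl, hst⟩ := ih
    refine ⟨n + 1, Fin.cons x S, rfl, ?_, fun i => ?_⟩
    · rw [← Fin.succ_last, Fin.cons_succ, hl]
    · refine Fin.cases ?_ (fun j => ?_) i
      · simpa [h0] using hxz
      · rw [Fin.cons_succ, ← Fin.succ_castSucc, Fin.cons_succ]
        exact hst j

theorem Good.language_nonempty {n : ℕ} {c : Bool} {a : Alph} {d : D}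
    (h : Good A Set.univ n ⟨c, false⟩ a d {(A.init, d)}) : (A.language D).Nonempty := by
  obtain ⟨c, s, hc, hs, hcl⟩ := h.exists_forest (Set.finite_singleton _)
  -- The initial type has no sibling, so the forest is a single tree hanging at the root.
  obtain rfl : s = .nil := by cases s with
    | nil => rfl
    | cons => simp [Forest.isCons] at hs
  have hat : At (Forest.toTree (a, d) c) [] (a, d) c .nil := by
    refine ⟨?_, fun j y => ?_, fun x i h => by simp at h, fun h => by simp [Forest.isCons] at h⟩
    · rw [Forest.look_toTree]; rfl
    · rw [Forest.look_toTree]; rfl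
  obtain ⟨ho, S', hr, he⟩ := hcl _ [] {(A.init, d)} (by simp) hat
  obtain ⟨m, S, h0, hl, hst⟩ := exists_seq_of_reflTransGen hr
  refine ⟨Forest.toTree (a, d) c, m, S, ⟨⟨_, a, d, h0⟩, fun i => (hst i).1, fun i => ?_⟩, ?_⟩
  · refine Fin.cases ?_ (fun j => ?_) i
    · rw [h0]; exact ho
    · cases m with
      | zero => exact j.elim0
      | succ m => exact (hst j).2
  · rw [hl]; exact he

/-- The language is nonempty if and only if some initial configuration is winning. -/
theorem language_nonempty_iff [Infinite D] : (A.language D).Nonempty ↔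
    ∃ n c a d, Good A Set.univ n ⟨c, false⟩ a (d : D) {(A.init, d)} :=
  ⟨fun ⟨_, hT⟩ => exists_good_of_mem_language hT, fun ⟨_, _, _, _, h⟩ => h.language_nonempty⟩

end Build

end ATRA

namespace ATRA

/-! ### Automata given by codes -/

def decodeTest (n : ℕ) : TypeTest :=
  if n = 0 then .child else if n = 1 then .noChild else if n = 2 then .sibling else .noSibling

/-- The instruction with a given opcode and arguments. Opcodes out of range are read as `spread`. -/
def decodeInstr : ℕ × ℕ × ℕ → Instr ℕ ℕ
  | (0, x, _) => .letter x
  | (1, x, _) => .notLetter x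
  | (2, x, _) => .test (decodeTest x)
  | (3, x, _) => .store x
  | (4, _, _) => .eq
  | (5, _, _) => .neq
  | (6, x, y) => .and x y
  | (7, x, y) => .or x y
  | (8, x, _) => .down x
  | (9, x, _) => .right x
  | (10, x, _) => .guess x
  | (_ + 11, x, y) => .spread x y

/-- The default is the instruction `eq`. It makes the coded automaton total; the numbers of actual
states never reach it. -/
def codeInstr (c : Code) (q : ℕ) : ℕ × ℕ × ℕ := c.2.2.getD q (4, 0, 0)

/-- The automaton with letters and states in `ℕ` described by a code. -/
def codeAut (c : Code) : Automaton ℕ ℕ := ⟨c.2.1, fun q => decodeInstr (codeInstr c q)⟩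

def codeLetters (c : Code) : Set ℕ := {a | a < c.1}

/-- The automaton described by `c` accepts some tree with data in `ℕ`. -/
def CodeNonempty (c : Code) : Prop :=
  ∃ n ch, ∃ a ∈ codeLetters c, ∃ d : ℕ,
    Good (codeAut c) (codeLetters c) n ⟨ch, false⟩ a d {(c.2.1, d)}

/-! ### Independence of the data domain and of the naming of letters and states -/

section Transfer

variable {Alph : Type v} {Q : Type w} {k m : ℕ} (A : Automaton Alph Q)
  (eA : Alph ≃ Fin k) (eQ : Q ≃ Fin m)

theorem decodeInstr_code (i : Instr Alph Q) :
    InstrRel (fun a' a => a' = (eA a : ℕ)) (fun q' q => q' = (eQ q : ℕ))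
      (decodeInstr (i.code eA eQ)) i := by
  cases i with
  | test b => cases b <;> exact .test
  | _ => constructor <;> rfl

/-- A correspondence transfers winning in one direction only, so it is needed both ways. -/
theorem decodeInstr_code_symm (i : Instr Alph Q) :
    InstrRel (fun a a' => a' = (eA a : ℕ)) (fun q q' => q' = (eQ q : ℕ)) i
      (decodeInstr (i.code eA eQ)) := by
  cases i with
  | test b => cases b <;> exact .test
  | _ => constructor <;> rfl

theorem codeInstr_code (q : Q) :
    codeInstr (A.code eA eQ) (eQ q) = (A.δ q).code eA eQ := by
  simp [codeInstr, Automaton.code, List.getD]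

theorem corr_code : Corr (codeAut (A.code eA eQ)) A (codeLetters (A.code eA eQ)) Set.univ
    (fun a' a => a' = (eA a : ℕ)) (fun q' q => q' = (eQ q : ℕ)) where
  letters_biUnique := by rintro _ a _ b rfl rfl; simp [Fin.val_inj]
  states_biUnique := by rintro _ a _ b rfl rfl; simp [Fin.val_inj]
  instr := by
    rintro _ q rfl
    simp only [codeAut, codeInstr_code]
    exact decodeInstr_code eA eQ _
  letters a _ := ⟨eA a, (eA a).2, rfl⟩

theorem corr_code_symm : Corr A (codeAut (A.code eA eQ)) Set.univ (codeLetters (A.code eA eQ))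
    (fun a a' => a' = (eA a : ℕ)) (fun q q' => q' = (eQ q : ℕ)) where
  letters_biUnique := by rintro a _ b _ rfl rfl; simp [Fin.val_inj]
  states_biUnique := by rintro a _ b _ rfl rfl; simp [Fin.val_inj]
  instr := by
    rintro q _ rfl
    simp only [codeAut, codeInstr_code]
    exact decodeInstr_code_symm eA eQ _
  letters a ha := ⟨eA.symm ⟨a, ha⟩, trivial, by simp⟩

theorem finPairs_single {X : Type*} {Y : Type*} (x : X) (y : Y) :
    FinPairs (fun x' y' => x' = x ∧ y' = y) :=
  (Set.finite_singleton (x, y)).subset fun _ hp => Prod.ext hp.1 hp.2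

theorem biUnique_single {X : Type*} {Y : Type*} (x : X) (y : Y) :
    BiUnique (fun x' y' => x' = x ∧ y' = y) := by
  rintro _ _ _ _ ⟨rfl, rfl⟩ ⟨rfl, rfl⟩; simp

/-- Two simulations between `D` and `ℕ`, both infinite, starting from the correspondence that pairs
only the two root data. -/
theorem language_nonempty_iff_code (D : Type u) [Infinite D] :
    (A.language D).Nonempty ↔ CodeNonempty (A.code eA eQ) := by
  rw [language_nonempty_iff]
  constructor
  · rintro ⟨n, ch, a, d, h⟩
    exact ⟨n, ch, eA a, (eA a).2, 0, (corr_code A eA eQ).good (finPairs_single 0 d)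
      (biUnique_single 0 d) rfl ⟨rfl, rfl⟩ (below_singleton rfl ⟨rfl, rfl⟩) h⟩
  · rintro ⟨n, ch, a, ha, d, h⟩
    obtain ⟨a', -, haa⟩ := (corr_code_symm A eA eQ).letters a ha
    let e : D := Classical.arbitrary D
    exact ⟨n, ch, a', e, (corr_code_symm A eA eQ).good (finPairs_single e d)
      (biUnique_single e d) haa ⟨rfl, rfl⟩ (below_singleton rfl ⟨rfl, rfl⟩) h⟩

end Transfer

/-! ### Successors as lists -/

/-- Node configurations with data and states in `ℕ`: type, letter, datum, threads. -/
abbrev ListConf := (Bool × Bool) × ℕ × ℕ × List (ℕ × ℕ)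

def toType (b : Bool × Bool) : TreeType := ⟨b.1, b.2⟩

def listSet {X : Type*} (l : List X) : Set X := {x | x ∈ l}

theorem finite_listSet {X : Type*} (l : List X) : (listSet l).Finite := List.finite_toSet l

def testHolds (n : ℕ) (b : Bool × Bool) : Bool :=
  if n = 0 then b.1 else if n = 1 then !b.1 else if n = 2 then b.2 else !b.2

theorem testHolds_iff (n : ℕ) (b : Bool × Bool) :
    testHolds n b = true ↔ (decodeTest n).Holds (toType b) := by
  unfold testHolds decodeTest
  split_ifs <;> simp [TypeTest.Holds, toType]

/-- The sets of threads by which a thread with register value `x` and the instruction coded by `i`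
can be replaced, unless `i` is moving or a `spread`; guessed data are less than `M`. -/
def threadSucc (i : ℕ × ℕ × ℕ) (M : ℕ) (b : Bool × Bool) (a d x : ℕ) : List (List (ℕ × ℕ)) :=
  if i.1 = 0 then (if i.2.1 = a then [[]] else [])
  else if i.1 = 1 then (if i.2.1 = a then [] else [[]])
  else if i.1 = 2 then (if testHolds i.2.1 b = true then [[]] else [])
  else if i.1 = 3 then [[(i.2.1, d)]]
  else if i.1 = 4 then (if d = x then [[]] else [])
  else if i.1 = 5 then (if d = x then [] else [[]])
  else if i.1 = 6 then [[(i.2.1, x), (i.2.2, x)]]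
  else if i.1 = 7 then [[(i.2.1, x)], [(i.2.2, x)]]
  else if i.1 = 10 then (List.range M).map fun e => [(i.2.1, e)]
  else []

/-- The threads created by a `spread` with arguments `q₂` and `q₁`. -/
def spreadList (q₂ q₁ : ℕ) (Δ : List (ℕ × ℕ)) : List (ℕ × ℕ) :=
  Δ.flatMap fun s => if s.1 = q₂ then [(q₁, s.2)] else []

def downList (c : Code) (Γ : List (ℕ × ℕ)) : List (ℕ × ℕ) :=
  Γ.flatMap fun s => if (codeInstr c s.1).1 = 8 then [((codeInstr c s.1).2.1, s.2)] else []

def rightList (c : Code) (Γ : List (ℕ × ℕ)) : List (ℕ × ℕ) :=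
  Γ.flatMap fun s => if (codeInstr c s.1).1 = 9 then [((codeInstr c s.1).2.1, s.2)] else []

def MovingList (c : Code) (Γ : List (ℕ × ℕ)) : Prop :=
  ∀ s ∈ Γ, (codeInstr c s.1).1 = 8 ∨ (codeInstr c s.1).1 = 9

instance (c : Code) (Γ : List (ℕ × ℕ)) : Decidable (MovingList c Γ) := by
  unfold MovingList; infer_instance

def SpreadReady (c : Code) (Γ : List (ℕ × ℕ)) : Prop :=
  ∀ s ∈ Γ, 11 ≤ (codeInstr c s.1).1 ∨ (codeInstr c s.1).1 = 8 ∨ (codeInstr c s.1).1 = 9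

instance (c : Code) (Γ : List (ℕ × ℕ)) : Decidable (SpreadReady c Γ) := by
  unfold SpreadReady; infer_instance

/-- The thread lists after a non-moving step that rewrites the thread `t`. -/
def rewriteSucc (c : Code) (M : ℕ) (r : ListConf) (t : ℕ × ℕ) : List (List (ℕ × ℕ)) :=
  (threadSucc (codeInstr c t.1) M r.1 r.2.1 r.2.2.1 t.2).map (fun N => N ++ r.2.2.2.filter fun s => s ≠ t) ++
  if 11 ≤ (codeInstr c t.1).1 ∧ SpreadReady c (r.2.2.2.filter fun s => s ≠ t) then
    [spreadList (codeInstr c t.1).2.1 (codeInstr c t.1).2.2 (r.2.2.2.filter fun s => s ≠ t) ++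
      r.2.2.2.filter fun s => s ≠ t]
  else []

/-- The thread lists after a non-moving step. -/
def epsSucc (c : Code) (M : ℕ) (r : ListConf) : List (List (ℕ × ℕ)) :=
  r.2.2.2.flatMap (rewriteSucc c M r)

/-! ### Correctness of the list operations -/

section Succ

variable {c : Code} {M : ℕ}

theorem listSet_append {X : Type*} (l l' : List X) :
    listSet (l ++ l') = listSet l ∪ listSet l' := by
  ext; simp [listSet]

theorem listSet_filter_ne (Γ : List (ℕ × ℕ)) (t : ℕ × ℕ) :
    listSet (Γ.filter fun s => s ≠ t) = listSet Γ \ {t} := by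
  ext; simp [listSet]

theorem mem_listSet {X : Type*} {l : List X} {x : X} : x ∈ listSet l ↔ x ∈ l := Iff.rfl

@[simp] theorem listSet_nil {X : Type*} : listSet ([] : List X) = ∅ := by ext; simp [listSet]

@[simp] theorem listSet_singleton {X : Type*} (x : X) : listSet [x] = {x} := by
  ext; simp [listSet]

/-- Splitting by literal opcodes lets `decodeInstr` and the tests in `threadSucc` reduce in each
case. -/
theorem decodeInstr_cases {p : ℕ × ℕ × ℕ → Prop} (h0 : ∀ x y, p (0, x, y))
    (h1 : ∀ x y, p (1, x, y)) (h2 : ∀ x y, p (2, x, y)) (h3 : ∀ x y, p (3, x, y))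
    (h4 : ∀ x y, p (4, x, y)) (h5 : ∀ x y, p (5, x, y)) (h6 : ∀ x y, p (6, x, y))
    (h7 : ∀ x y, p (7, x, y)) (h8 : ∀ x y, p (8, x, y)) (h9 : ∀ x y, p (9, x, y))
    (h10 : ∀ x y, p (10, x, y)) (h11 : ∀ n x y, p (n + 11, x, y)) : ∀ i, p i
  | (0, x, y) => h0 x y
  | (1, x, y) => h1 x y
  | (2, x, y) => h2 x y
  | (3, x, y) => h3 x y
  | (4, x, y) => h4 x y
  | (5, x, y) => h5 x y
  | (6, x, y) => h6 x y
  | (7, x, y) => h7 x y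
  | (8, x, y) => h8 x y
  | (9, x, y) => h9 x y
  | (10, x, y) => h10 x y
  | (n + 11, x, y) => h11 n x y

theorem isMoving_decodeInstr (i : ℕ × ℕ × ℕ) :
    (decodeInstr i).IsMoving ↔ i.1 = 8 ∨ i.1 = 9 := by
  revert i
  apply decodeInstr_cases <;> intros <;> simp [decodeInstr, Instr.IsMoving]

theorem isSpread_decodeInstr (i : ℕ × ℕ × ℕ) : (decodeInstr i).IsSpread ↔ 11 ≤ i.1 := by
  revert i
  apply decodeInstr_cases <;> intros <;> simp [decodeInstr, Instr.IsSpread]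

theorem decodeInstr_eq_spread {q₂ q₁ : ℕ} (i : ℕ × ℕ × ℕ) :
    decodeInstr i = .spread q₂ q₁ ↔ 11 ≤ i.1 ∧ i.2.1 = q₂ ∧ i.2.2 = q₁ := by
  revert i
  apply decodeInstr_cases <;> intros <;> simp [decodeInstr]

theorem decodeInstr_eq_down {q : ℕ} (i : ℕ × ℕ × ℕ) :
    decodeInstr i = .down q ↔ i.1 = 8 ∧ i.2.1 = q := by
  revert i
  apply decodeInstr_cases <;> intros <;> simp [decodeInstr]

theorem decodeInstr_eq_right {q : ℕ} (i : ℕ × ℕ × ℕ) :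
    decodeInstr i = .right q ↔ i.1 = 9 ∧ i.2.1 = q := by
  revert i
  apply decodeInstr_cases <;> intros <;> simp [decodeInstr]

theorem movingList_iff {Γ : List (ℕ × ℕ)} :
    MovingList c Γ ↔ ∀ t ∈ listSet Γ, ((codeAut c).δ t.1).IsMoving := by
  simp only [MovingList, codeAut, isMoving_decodeInstr, mem_listSet]

theorem spreadReady_iff {Γ : List (ℕ × ℕ)} : SpreadReady c Γ ↔
    ∀ t ∈ listSet Γ, ((codeAut c).δ t.1).IsSpread ∨ ((codeAut c).δ t.1).IsMoving := by
  simp only [SpreadReady, codeAut, isMoving_decodeInstr, isSpread_decodeInstr, mem_listSet]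

theorem listSet_downList (Γ : List (ℕ × ℕ)) :
    listSet (downList c Γ) = downSet (codeAut c) (listSet Γ) := by
  ext ⟨p, x⟩
  simp only [listSet, downList, List.mem_flatMap, downSet, codeAut, decodeInstr_eq_down]
  constructor
  · rintro ⟨⟨q, y⟩, hq, h⟩
    split_ifs at h with h8
    · simp only [List.mem_singleton, Prod.mk.injEq] at h
      obtain ⟨rfl, rfl⟩ := h
      exact ⟨q, hq, h8, rfl⟩
    · simp at h
  · rintro ⟨q, hq, h8, h⟩
    simp only at h
    exact ⟨(q, x), hq, by simp [h8, h]⟩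

theorem listSet_rightList (Γ : List (ℕ × ℕ)) :
    listSet (rightList c Γ) = rightSet (codeAut c) (listSet Γ) := by
  ext ⟨p, x⟩
  simp only [listSet, rightList, List.mem_flatMap, rightSet, codeAut, decodeInstr_eq_right]
  constructor
  · rintro ⟨⟨q, y⟩, hq, h⟩
    split_ifs at h with h8
    · simp only [List.mem_singleton, Prod.mk.injEq] at h
      obtain ⟨rfl, rfl⟩ := h
      exact ⟨q, hq, h8, rfl⟩
    · simp at h
  · rintro ⟨q, hq, h8, h⟩
    simp only at h
    exact ⟨(q, x), hq, by simp [h8, h]⟩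

theorem listSet_spreadList (q₂ q₁ : ℕ) (Δ : List (ℕ × ℕ)) :
    listSet (spreadList q₂ q₁ Δ) = spreadSet q₂ q₁ (listSet Δ) := by
  ext ⟨p, x⟩
  simp only [listSet, spreadList, List.mem_flatMap, spreadSet]
  constructor
  · rintro ⟨⟨q, y⟩, hq, h⟩
    split_ifs at h with h8
    · simp only [List.mem_singleton, Prod.mk.injEq] at h
      obtain ⟨rfl, rfl⟩ := h
      subst h8
      exact ⟨rfl, hq⟩
    · simp at h
  · rintro ⟨rfl, h⟩
    exact ⟨(q₂, x), h, by simp⟩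

theorem threadStep_of_mem_threadSucc {b : Bool × Bool} {a d q x : ℕ}
    {N : List (ℕ × ℕ)} (h : N ∈ threadSucc (codeInstr c q) M b a d x) :
    ThreadStep (codeAut c) (toType b) a d (q, x) (listSet N) := by
  have hδ : (codeAut c).δ q = decodeInstr (codeInstr c q) := rfl
  generalize codeInstr c q = i at h hδ
  revert h hδ
  revert i
  apply decodeInstr_cases <;> intros <;> rename_i h hδ <;>
    simp [decodeInstr, threadSucc] at h hδ
  · obtain ⟨h, rfl⟩ := h
    rw [listSet_nil]; exact .letter hδ h
  · obtain ⟨h, rfl⟩ := h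
    rw [listSet_nil]; exact .notLetter hδ h
  · obtain ⟨h, rfl⟩ := h
    rw [listSet_nil]; exact .test hδ ((testHolds_iff _ _).1 h)
  · subst h; rw [listSet_singleton]; exact .store hδ
  · obtain ⟨h, rfl⟩ := h
    rw [listSet_nil]; exact .eq hδ h
  · obtain ⟨h, rfl⟩ := h
    rw [listSet_nil]; exact .neq hδ h
  · subst h
    convert ThreadStep.and hδ using 1
    ext; simp [listSet]
  · rcases h with rfl | rfl
    · rw [listSet_singleton]; exact .or_left hδ
    · rw [listSet_singleton]; exact .or_right hδ
  · obtain ⟨e, he, rfl⟩ := h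
    rw [listSet_singleton]; exact .guess e hδ

/-- Infinitely many data can be guessed but the list holds only those below `M`; the bound on `N`
excludes the others. -/
theorem exists_mem_threadSucc {b : Bool × Bool} {a d q x : ℕ} {N : Set (ℕ × ℕ)}
    (h : ThreadStep (codeAut c) (toType b) a d (q, x) N) (hM : ∀ t ∈ N, t.2 < M) :
    ∃ N' ∈ threadSucc (codeInstr c q) M b a d x, listSet N' = N := by
  have hδ : (codeAut c).δ q = decodeInstr (codeInstr c q) := rfl
  generalize codeInstr c q = i at hδ
  revert hδ
  revert i
  cases h with
  | or_left hi =>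
    rw [hi]
    apply decodeInstr_cases <;> intros <;> rename_i hδ <;> simp [decodeInstr] at hδ
    obtain ⟨rfl, rfl⟩ := hδ; exact ⟨[_], by simp [threadSucc]; left; rfl, by simp⟩
  | or_right hi =>
    rw [hi]
    apply decodeInstr_cases <;> intros <;> rename_i hδ <;> simp [decodeInstr] at hδ
    obtain ⟨rfl, rfl⟩ := hδ; exact ⟨[_], by simp [threadSucc]; right; rfl, by simp⟩
  | and hi =>
    rw [hi]
    apply decodeInstr_cases <;> intros <;> rename_i hδ <;> simp [decodeInstr] at hδ
    obtain ⟨rfl, rfl⟩ := hδ; exact ⟨[_, _], by simp [threadSucc]; exact ⟨rfl, rfl⟩, by ext; simp [listSet]⟩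
  | store hi =>
    rw [hi]
    apply decodeInstr_cases <;> intros <;> rename_i hδ <;> simp [decodeInstr] at hδ
    subst hδ; exact ⟨[_], by simp [threadSucc]; rfl, by simp⟩
  | eq hi h =>
    rw [hi]
    apply decodeInstr_cases <;> intros <;> rename_i hδ <;> simp [decodeInstr] at hδ
    exact ⟨[], by simp [threadSucc, h], by simp⟩
  | neq hi h =>
    rw [hi]
    apply decodeInstr_cases <;> intros <;> rename_i hδ <;> simp [decodeInstr] at hδ
    exact ⟨[], by simp [threadSucc, h], by simp⟩
  | test hi h =>
    rw [hi]
    apply decodeInstr_cases <;> intros <;> rename_i hδ <;> simp [decodeInstr] at hδ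
    subst hδ; exact ⟨[], by simp [threadSucc, (testHolds_iff _ _).2 h], by simp⟩
  | letter hi h =>
    rw [hi]
    apply decodeInstr_cases <;> intros <;> rename_i hδ <;> simp [decodeInstr] at hδ
    subst hδ; exact ⟨[], by simp [threadSucc, h], by simp⟩
  | notLetter hi h =>
    rw [hi]
    apply decodeInstr_cases <;> intros <;> rename_i hδ <;> simp [decodeInstr] at hδ
    subst hδ; exact ⟨[], by simp [threadSucc, h], by simp⟩
  | guess e hi =>
    rw [hi]
    apply decodeInstr_cases <;> intros <;> rename_i hδ <;> simp [decodeInstr] at hδ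
    subst hδ; exact ⟨[(_, e)], by simp [threadSucc]; exact ⟨hM _ rfl, rfl⟩, by simp⟩

/-- Used in both directions of the decision: a justified entry wins, and a successor of a losing
configuration loses. -/
theorem pre_of_mem_epsSucc {r : ListConf} {Δ : List (ℕ × ℕ)} (h : Δ ∈ epsSucc c M r)
    {L : Set ℕ} {P : TreeType → ℕ → ℕ → Set (ℕ × ℕ) → Prop}
    (hP : P (toType r.1) r.2.1 r.2.2.1 (listSet Δ)) :
    Pre (codeAut c) L P (toType r.1) r.2.1 r.2.2.1 (listSet r.2.2.2) := by
  obtain ⟨t, ht, h⟩ := List.mem_flatMap.1 h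
  rcases List.mem_append.1 h with h | h
  · obtain ⟨N, hN, rfl⟩ := List.mem_map.1 h
    rw [listSet_append, listSet_filter_ne] at hP
    exact .thread ht (threadStep_of_mem_threadSucc hN) hP
  · split_ifs at h with hs
    · obtain rfl := List.mem_singleton.1 h
      rw [listSet_append, listSet_spreadList, listSet_filter_ne] at hP
      have h2 := spreadReady_iff.1 hs.2
      rw [listSet_filter_ne] at h2
      exact .spread ht ((decodeInstr_eq_spread _).2 ⟨hs.1, rfl, rfl⟩) h2 hP
    · simp at h

theorem exists_mem_epsSucc_of_threadStep {r : ListConf} {t : ℕ × ℕ} (ht : t ∈ listSet r.2.2.2)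
    {N : Set (ℕ × ℕ)} (h : ThreadStep (codeAut c) (toType r.1) r.2.1 r.2.2.1 t N)
    (hM : ∀ t ∈ N, t.2 < M) : ∃ Δ ∈ epsSucc c M r, listSet Δ = N ∪ listSet r.2.2.2 \ {t} := by
  obtain ⟨N', hN', rfl⟩ := exists_mem_threadSucc h hM
  refine ⟨N' ++ r.2.2.2.filter fun s => s ≠ t, List.mem_flatMap.2 ⟨t, ht, List.mem_append_left _
    (List.mem_map.2 ⟨N', hN', rfl⟩)⟩, ?_⟩
  rw [listSet_append, listSet_filter_ne]

theorem exists_mem_epsSucc_of_spread {r : ListConf} {t : ℕ × ℕ} (ht : t ∈ listSet r.2.2.2)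
    {q₂ q₁ : ℕ} (hδ : (codeAut c).δ t.1 = .spread q₂ q₁)
    (h : ∀ s ∈ listSet r.2.2.2 \ {t}, ((codeAut c).δ s.1).IsSpread ∨
      ((codeAut c).δ s.1).IsMoving) :
    ∃ Δ ∈ epsSucc c M r,
      listSet Δ = spreadSet q₂ q₁ (listSet r.2.2.2 \ {t}) ∪ listSet r.2.2.2 \ {t} := by
  obtain ⟨h1, rfl, rfl⟩ := (decodeInstr_eq_spread _).1 hδ
  rw [← listSet_filter_ne, ← spreadReady_iff] at h
  refine ⟨spreadList (codeInstr c t.1).2.1 (codeInstr c t.1).2.2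
    (r.2.2.2.filter fun s => s ≠ t) ++ r.2.2.2.filter fun s => s ≠ t,
    List.mem_flatMap.2 ⟨t, ht, List.mem_append_right _ ?_⟩, ?_⟩
  · rw [if_pos ⟨h1, h⟩]
    exact List.mem_singleton.2 rfl
  · rw [listSet_append, listSet_spreadList, listSet_filter_ne]

end Succ

end ATRA

namespace ATRA

/-! ### Certificates of nonemptiness -/

/-- The entry `s` is justified by entries of `L` with a smaller number. -/
def GoodJust (c : Code) (M : ℕ) (L : List (ℕ × ListConf)) (s : ℕ × ListConf) : Prop :=
  s.2.2.2.2 = [] ∨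
  (∃ Δ ∈ epsSucc c M s.2, ∃ g ∈ L, g.1 < s.1 ∧ g.2.1 = s.2.1 ∧ g.2.2.1 = s.2.2.1 ∧
    g.2.2.2.1 = s.2.2.2.1 ∧ ∀ t ∈ Δ, t ∈ g.2.2.2.2) ∨
  (MovingList c s.2.2.2.2 ∧ (s.2.1.1 = true ∨ s.2.1.2 = true) ∧
    (s.2.1.1 = false ∨ ∃ g ∈ L, g.1 < s.1 ∧ g.2.2.1 < c.1 ∧
      ∀ t ∈ downList c s.2.2.2.2, t ∈ g.2.2.2.2) ∧
    (s.2.1.2 = false ∨ ∃ g ∈ L, g.1 < s.1 ∧ g.2.2.1 < c.1 ∧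
      ∀ t ∈ rightList c s.2.2.2.2, t ∈ g.2.2.2.2))

/-- `p.2` lists winning configurations, each justified by earlier ones, one of them initial. -/
def GoodCert (c : Code) (p : ℕ × List (ℕ × ListConf)) : Prop :=
  (∀ s ∈ p.2, GoodJust c p.1 p.2 s) ∧
    ∃ s ∈ p.2, s.2.1.2 = false ∧ s.2.2.1 < c.1 ∧ (c.2.1, s.2.2.2.1) ∈ s.2.2.2.2

/-- The configuration is winning in height `n`. -/
def ListGood (c : Code) (n : ℕ) (r : ListConf) : Prop :=
  Good (codeAut c) (codeLetters c) n (toType r.1) r.2.1 r.2.2.1 (listSet r.2.2.2)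

variable {c : Code} {M : ℕ}

theorem ListGood.anti {n : ℕ} {r : ListConf} (h : ListGood c n r) {Γ : Set (ℕ × ℕ)}
    (hΓ : Γ ⊆ listSet r.2.2.2) :
    Good (codeAut c) (codeLetters c) n (toType r.1) r.2.1 r.2.2.1 Γ :=
  Good.anti (finite_listSet _) hΓ h

/-- The numbers strictly decrease along justifications, which rules out circular ones; an entry
numbered `n` wins in height `n + 1`. -/
theorem listGood_of_goodJust {L : List (ℕ × ListConf)} (hL : ∀ s ∈ L, GoodJust c M L s) (n : ℕ) :
    ∀ s ∈ L, s.1 = n → ListGood c (n + 1) s.2 := by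
  induction n using Nat.strong_induction_on with
  | _ n ih =>
    rintro ⟨n', r⟩ hs rfl
    simp only at ih
    have ih' : ∀ g ∈ L, g.1 < n' → ListGood c n' g.2 := fun g hg hlt =>
      Good.mono hlt (ih _ hlt g hg rfl)
    rcases hL _ hs with h | ⟨Δ, hΔ, g, hg, hlt, h1, h2, h3, h4⟩ | ⟨hm, hcs, hc, hs⟩
    · simp only at h
      unfold ListGood
      rw [h, listSet_nil]
      exact .empty
    · refine pre_of_mem_epsSucc hΔ ?_
      simp only at h1 h2 h3
      rw [← h1, ← h2, ← h3]
      exact (ih' g hg hlt).anti h4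
    · refine .move (movingList_iff.1 hm) hcs (fun h => ?_) (fun h => ?_)
      · obtain h' | ⟨g, hg, hlt, ha, hsub⟩ := hc
        · simp_all [toType]
        · refine ⟨_, _, ha, _, (ih' g hg hlt).anti ?_⟩
          rw [← listSet_downList]; exact hsub
      · obtain h' | ⟨g, hg, hlt, ha, hsub⟩ := hs
        · simp_all [toType]
        · refine ⟨_, _, ha, _, (ih' g hg hlt).anti ?_⟩
          rw [← listSet_rightList]; exact hsub

theorem threadSucc_mono {M' : ℕ} (hM : M ≤ M') {b : Bool × Bool} {a d x : ℕ}
    {N : List (ℕ × ℕ)} (i : ℕ × ℕ × ℕ) (h : N ∈ threadSucc i M b a d x) :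
    N ∈ threadSucc i M' b a d x := by
  revert h
  revert i
  apply decodeInstr_cases <;> intros <;> rename_i h <;> try exact h
  simp only [threadSucc, reduceIte, OfNat.ofNat_ne_zero, OfNat.ofNat_ne_one,
    Nat.reduceEqDiff, List.mem_map, List.mem_range] at h ⊢
  obtain ⟨e, he, rfl⟩ := h
  exact ⟨e, he.trans_le hM, rfl⟩

theorem epsSucc_mono {M' : ℕ} (hM : M ≤ M') {r : ListConf} {Δ : List (ℕ × ℕ)}
    (h : Δ ∈ epsSucc c M r) : Δ ∈ epsSucc c M' r := by
  obtain ⟨t, ht, h⟩ := List.mem_flatMap.1 h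
  refine List.mem_flatMap.2 ⟨t, ht, ?_⟩
  rcases List.mem_append.1 h with h | h
  · obtain ⟨N, hN, rfl⟩ := List.mem_map.1 h
    exact List.mem_append_left _ (List.mem_map.2 ⟨N, threadSucc_mono hM _ hN, rfl⟩)
  · exact List.mem_append_right _ h

theorem GoodJust.mono {M' : ℕ} (hM : M ≤ M') {L L' : List (ℕ × ListConf)} (hL : L ⊆ L')
    {s : ℕ × ListConf} (h : GoodJust c M L s) : GoodJust c M' L' s := by
  rcases h with h | ⟨Δ, hΔ, g, hg, h⟩ | ⟨hm, hcs, hc, hs⟩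
  · exact .inl h
  · exact .inr (.inl ⟨Δ, epsSucc_mono hM hΔ, g, hL hg, h⟩)
  · exact .inr (.inr ⟨hm, hcs, hc.imp_right fun ⟨g, hg, h⟩ => ⟨g, hL hg, h⟩,
      hs.imp_right fun ⟨g, hg, h⟩ => ⟨g, hL hg, h⟩⟩)

theorem exists_bound {Γ : Set (ℕ × ℕ)} (h : Γ.Finite) : ∃ M, ∀ t ∈ Γ, t.2 < M := by
  obtain ⟨M, hM⟩ := (h.image Prod.snd).bddAbove
  exact ⟨M + 1, fun t ht => Nat.lt_succ_of_le (hM ⟨t, ht, rfl⟩)⟩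

/-- The height serves as number. Certificates of the successors are concatenated, and `M` is raised
to exceed all data guessed in the derivation; justifications survive both changes. -/
theorem ListGood.exists_cert {n : ℕ} : ∀ {r : ListConf}, ListGood c n r →
    ∃ M L, (∀ s ∈ L, GoodJust c M L s) ∧ (n, r) ∈ L := by
  induction n with
  | zero => intro r h; exact h.elim
  | succ n ih =>
    rintro ⟨b, a, d, Γ⟩ h
    have eps : ∀ {M Δ}, Δ ∈ epsSucc c M (b, a, d, Γ) → ListGood c n (b, a, d, Δ) →
        ∃ M L, (∀ s ∈ L, GoodJust c M L s) ∧ (n + 1, (b, a, d, Γ)) ∈ L := by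
      intro M Δ hΔ hG
      obtain ⟨M', L, hL, hmem⟩ := ih hG
      refine ⟨max M M', (n + 1, (b, a, d, Γ)) :: L, ?_, List.mem_cons_self⟩
      intro s hs
      rcases List.mem_cons.1 hs with rfl | hs
      · exact .inr (.inl ⟨Δ, epsSucc_mono (le_max_left _ _) hΔ, _, List.mem_cons_of_mem _ hmem,
          Nat.lt_succ_self n, rfl, rfl, rfl, fun t ht => ht⟩)
      · exact (hL s hs).mono (le_max_right _ _) (List.subset_cons_self _ _)
    unfold ListGood at h
    simp only at h
    generalize hΓ : listSet Γ = Γ' at h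
    cases h with
    | empty =>
      refine ⟨0, [(n + 1, (b, a, d, Γ))], fun s hs => ?_, List.mem_singleton.2 rfl⟩
      obtain rfl := List.mem_singleton.1 hs
      refine .inl (List.eq_nil_iff_forall_not_mem.2 fun t ht => ?_)
      have : t ∈ listSet Γ := ht
      rw [hΓ] at this
      exact this
    | @thread _ N t ht hN hP =>
      subst hΓ
      obtain ⟨M, hM⟩ := exists_bound hN.finite
      obtain ⟨Δ, hΔ, hset⟩ := exists_mem_epsSucc_of_threadStep (r := (b, a, d, Γ)) ht hN hM
      refine eps hΔ ?_
      unfold ListGood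
      rw [hset]
      exact hP
    | @spread _ t q₁ q₂ ht hδ hall hP =>
      subst hΓ
      obtain ⟨Δ, hΔ, hset⟩ :=
        exists_mem_epsSucc_of_spread (M := 0) (r := (b, a, d, Γ)) ht hδ hall
      refine eps hΔ ?_
      unfold ListGood
      rw [hset]
      exact hP
    | move hm hcs hc hs =>
      subst hΓ
      have hc' : ∃ M L, (∀ s ∈ L, GoodJust c M L s) ∧ (b.1 = false ∨ ∃ g ∈ L, g.1 < n + 1 ∧
          g.2.2.1 < c.1 ∧ ∀ t ∈ downList c Γ, t ∈ g.2.2.2.2) := by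
        cases hb : b.1 with
        | false => exact ⟨0, [], by simp, .inl rfl⟩
        | true =>
          obtain ⟨β, a', ha', e, hP⟩ := hc hb
          rw [← listSet_downList] at hP
          obtain ⟨M, L, hL, hmem⟩ :=
            ih (r := ((β.child, β.sibling), a', e, downList c Γ)) hP
          exact ⟨M, L, hL, .inr ⟨_, hmem, Nat.lt_succ_self n, ha', fun t ht => ht⟩⟩
      have hs' : ∃ M L, (∀ s ∈ L, GoodJust c M L s) ∧ (b.2 = false ∨ ∃ g ∈ L, g.1 < n + 1 ∧
          g.2.2.1 < c.1 ∧ ∀ t ∈ rightList c Γ, t ∈ g.2.2.2.2) := by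
        cases hb : b.2 with
        | false => exact ⟨0, [], by simp, .inl rfl⟩
        | true =>
          obtain ⟨β, a', ha', e, hP⟩ := hs hb
          rw [← listSet_rightList] at hP
          obtain ⟨M, L, hL, hmem⟩ :=
            ih (r := ((β.child, β.sibling), a', e, rightList c Γ)) hP
          exact ⟨M, L, hL, .inr ⟨_, hmem, Nat.lt_succ_self n, ha', fun t ht => ht⟩⟩
      obtain ⟨M₁, L₁, hL₁, h₁⟩ := hc'
      obtain ⟨M₂, L₂, hL₂, h₂⟩ := hs'
      have hsub₁ : L₁ ⊆ (n + 1, (b, a, d, Γ)) :: (L₁ ++ L₂) := fun x hx => by simp [hx]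
      have hsub₂ : L₂ ⊆ (n + 1, (b, a, d, Γ)) :: (L₁ ++ L₂) := fun x hx => by simp [hx]
      refine ⟨max M₁ M₂, (n + 1, (b, a, d, Γ)) :: (L₁ ++ L₂), ?_, List.mem_cons_self⟩
      intro s hs
      rcases List.mem_cons.1 hs with rfl | hs
      · exact .inr (.inr ⟨movingList_iff.2 hm, hcs,
          h₁.imp_right fun ⟨g, hg, h⟩ => ⟨g, hsub₁ hg, h⟩,
          h₂.imp_right fun ⟨g, hg, h⟩ => ⟨g, hsub₂ hg, h⟩⟩)
      · rcases List.mem_append.1 hs with hs | hs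
        · exact (hL₁ s hs).mono (le_max_left _ _) hsub₁
        · exact (hL₂ s hs).mono (le_max_right _ _) hsub₂

theorem codeNonempty_iff_exists_goodCert : CodeNonempty c ↔ ∃ p, GoodCert c p := by
  constructor
  · rintro ⟨n, ch, a, ha, d, h⟩
    have h' : ListGood c n ((ch, false), a, d, [(c.2.1, d)]) := by
      unfold ListGood
      rw [listSet_singleton]
      exact h
    obtain ⟨M, L, hL, hmem⟩ := h'.exists_cert
    exact ⟨(M, L), hL, _, hmem, rfl, ha, by simp⟩
  · rintro ⟨⟨M, L⟩, hL, s, hs, hsib, ha, hstart⟩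
    have h := listGood_of_goodJust hL s.1 s hs rfl
    refine ⟨s.1 + 1, s.2.1.1, s.2.2.1, ha, s.2.2.2.1, ?_⟩
    have := h.anti (Γ := {(c.2.1, s.2.2.2.1)}) (by simpa [listSet] using hstart)
    rwa [toType, hsib] at this

end ATRA

namespace ATRA

/-! ### Certificates of emptiness -/

/-- Some configuration of `F` has the given type, letter and datum, and threads in `Δ`. -/
def BadCover (F : List ListConf) (b : Bool × Bool) (a d : ℕ) (Δ : List (ℕ × ℕ)) : Prop :=
  ∃ g ∈ F, g.1 = b ∧ g.2.1 = a ∧ g.2.2.1 = d ∧ ∀ t ∈ g.2.2.2, t ∈ Δ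

def boolPairs : List (Bool × Bool) := [(false, false), (false, true), (true, false), (true, true)]

theorem mem_boolPairs (b : Bool × Bool) : b ∈ boolPairs := by
  obtain ⟨_ | _, _ | _⟩ := b <;> simp [boolPairs]

/-- `BadCover` for all types, all letters, and all data less than `M`. -/
def AllCover (c : Code) (M : ℕ) (F : List ListConf) (Δ : List (ℕ × ℕ)) : Prop :=
  ∀ β ∈ boolPairs, ∀ a < c.1, ∀ e < M, BadCover F β a e Δ

/-- All steps from `f` lead above `F`, as far as data less than `M` are concerned. -/
def BadClosed (c : Code) (M : ℕ) (F : List ListConf) (f : ListConf) : Prop :=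
  f.2.2.2 ≠ [] ∧ f.2.2.1 < M ∧ (∀ t ∈ f.2.2.2, t.2 < M) ∧
  (∃ e < M, e ≠ f.2.2.1 ∧ ∀ t ∈ f.2.2.2, t.2 ≠ e) ∧
  (∀ Δ ∈ epsSucc c M f, BadCover F f.1 f.2.1 f.2.2.1 Δ) ∧
  (¬ MovingList c f.2.2.2 ∨ (f.1.1 = false ∧ f.1.2 = false) ∨
    (f.1.1 = true ∧ AllCover c M F (downList c f.2.2.2)) ∨
    (f.1.2 = true ∧ AllCover c M F (rightList c f.2.2.2)))

/-- `p.2` lists losing configurations below all steps, and below all initial configurations. -/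
def BadCert (c : Code) (p : ℕ × List ListConf) : Prop :=
  (∀ f ∈ p.2, BadClosed c p.1 p.2 f) ∧
    ∀ ch ∈ [false, true], ∀ a < c.1, BadCover p.2 (ch, false) a 0 [(c.2.1, 0)]

variable {c : Code} {M : ℕ}

theorem BadCover.not_good {F : List ListConf} {n : ℕ} (hF : ∀ f ∈ F, ¬ ListGood c n f)
    {b : Bool × Bool} {a d : ℕ} {Δ : List (ℕ × ℕ)} (h : BadCover F b a d Δ) :
    ¬ ListGood c n (b, a, d, Δ) := by
  obtain ⟨g, hg, rfl, rfl, rfl, hsub⟩ := h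
  exact fun hG => hF g hg (hG.anti hsub)

/-- The map sends `e'` to the large datum `e` and fixes everything else. Pulling a win back along it
replaces `e` by `e'`. -/
theorem injOn_update {e' e : ℕ} (he : M ≤ e) {S : Set ℕ} (hS : ∀ x ∈ S, x < M) :
    Set.InjOn (Function.update id e' e) S := by
  intro x hx y hy hxy
  by_cases h1 : x = e' <;> by_cases h2 : y = e'
  · rw [h1, h2]
  · subst h1
    rw [Function.update_self, Function.update_of_ne h2] at hxy
    have := hS y hy
    simp only [id] at hxy
    omega
  · subst h2
    rw [Function.update_self, Function.update_of_ne h1] at hxy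
    have := hS x hx
    simp only [id] at hxy
    omega
  · rwa [Function.update_of_ne h1, Function.update_of_ne h2] at hxy

/-! ### Restricting new data to a finite range -/

section Rename

variable {A : Automaton ℕ ℕ} {L : Set ℕ}

/-- A datum of the new node outside the range occurs in no thread, so the unused value `e'` does
just as well. -/
theorem Good.exists_lt {n : ℕ} {β : TreeType} {b e e' : ℕ} {Γ : Set (ℕ × ℕ)} (hfin : Γ.Finite)
    (hΓ : ∀ t ∈ Γ, t.2 < M) (he' : e' < M) (hfresh : ∀ t ∈ Γ, t.2 ≠ e')
    (h : Good A L n β b e Γ) : ∃ e < M, Good A L n β b e Γ := by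
  by_cases he : e < M
  · exact ⟨e, he, h⟩
  · refine ⟨e', he', h.rename (Function.update id e' e) hfin (Function.update_self ..)
      (injOn_update (not_lt.1 he) ?_) ?_⟩
    · rintro x (rfl | ⟨t, ht, rfl⟩)
      · exact he'
      · exact hΓ t ht
    · intro t ht
      rw [Function.update_of_ne (hfresh t ht)]
      exact ht

/-- The same replacement for a guessed datum. Here `e'` must also differ from the datum of the node,
since the comparison with it is observable. -/
theorem Good.exists_threadStep_lt {n : ℕ} {α : TreeType} {a d e' : ℕ} {Γ N : Set (ℕ × ℕ)}
    {t : ℕ × ℕ} (hfin : Γ.Finite) (hd : d < M) (hΓ : ∀ t ∈ Γ, t.2 < M) (he' : e' < M)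
    (hfd : e' ≠ d) (hfresh : ∀ t ∈ Γ, t.2 ≠ e') (ht : t ∈ Γ) (hN : ThreadStep A α a d t N)
    (h : Good A L n α a d (N ∪ Γ \ {t})) :
    ∃ N, ThreadStep A α a d t N ∧ (∀ t ∈ N, t.2 < M) ∧ Good A L n α a d (N ∪ Γ \ {t}) := by
  by_cases hNM : ∀ t ∈ N, t.2 < M
  · exact ⟨N, hN, hNM, h⟩
  have hx := hΓ t ht
  cases hN with
  | @guess q q' x e hδ =>
    have he : M ≤ e := by simpa using hNM
    refine ⟨_, .guess e' hδ, by simpa using he', h.rename (Function.update id e' e)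
      ((Set.finite_singleton _).union (hfin.subset Set.sdiff_subset))
      (Function.update_of_ne hfd.symm _ _) (injOn_update he ?_) ?_⟩
    · rintro x (rfl | ⟨t, (rfl | ht), rfl⟩)
      · exact hd
      · exact he'
      · exact hΓ t ht.1
    · rintro t (rfl | ht)
      · exact .inl (by simp)
      · rw [Function.update_of_ne (hfresh t ht.1)]
        exact .inr ht
  -- Every other instruction creates threads only with the datum of the node or the old register
  -- value, both below `M`.
  | _ => exact (hNM (by simp_all)).elim

end Rename

/-- Induction on the height of a supposed win. Its first step can be assumed to use data below `M`,
and then leads above a member of `F`, which would win in smaller height. At a move one lost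
direction is enough, because all directions present in the type must be won. -/
theorem not_listGood_of_badClosed {F : List ListConf} (hF : ∀ f ∈ F, BadClosed c M F f) (n : ℕ) :
    ∀ f ∈ F, ¬ ListGood c n f := by
  induction n with
  | zero => exact fun _ _ h => h
  | succ n ih =>
    rintro ⟨b, a, d, Γ⟩ hf hG
    obtain ⟨hne, hd, hΓ, ⟨e', he', hfd, hfresh⟩, heps, hmove⟩ := hF _ hf
    simp only at hne hd hΓ hfd hfresh heps hmove
    unfold ListGood at hG
    simp only at hG
    generalize hΓ' : listSet Γ = Γ' at hG
    cases hG with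
    | empty =>
      refine hne (List.eq_nil_iff_forall_not_mem.2 fun t ht => ?_)
      have : t ∈ listSet Γ := ht
      rw [hΓ'] at this
      exact this
    | @thread _ N t ht hN hP =>
      subst hΓ'
      obtain ⟨N, hN, hNM, hP⟩ := Good.exists_threadStep_lt (finite_listSet Γ) hd hΓ he' hfd
        hfresh ht hN hP
      obtain ⟨Δ, hΔ, hset⟩ := exists_mem_epsSucc_of_threadStep (r := (b, a, d, Γ)) ht hN hNM
      refine (heps Δ hΔ).not_good ih ?_
      unfold ListGood
      rw [hset]
      exact hP
    | @spread _ t q₁ q₂ ht hδ hall hP =>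
      subst hΓ'
      obtain ⟨Δ, hΔ, hset⟩ :=
        exists_mem_epsSucc_of_spread (M := M) (r := (b, a, d, Γ)) ht hδ hall
      refine (heps Δ hΔ).not_good ih ?_
      unfold ListGood
      rw [hset]
      exact hP
    | move hm hcs hc hs =>
      subst hΓ'
      rcases hmove with h | ⟨h1, h2⟩ | ⟨h1, h2⟩ | ⟨h1, h2⟩
      · exact h (movingList_iff.2 hm)
      · simp [toType, h1, h2] at hcs
      · obtain ⟨β, a', ha', e, hP⟩ := hc h1
        obtain ⟨e, he, hP⟩ := hP.exists_lt (finite_downSet (finite_listSet Γ))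
          (fun t ⟨q, hq, _⟩ => hΓ (q, t.2) hq) he' (fun t ⟨q, hq, _⟩ => hfresh (q, t.2) hq)
        rw [← listSet_downList] at hP
        exact (h2 (β.child, β.sibling) (mem_boolPairs _) a' ha' e he).not_good ih hP
      · obtain ⟨β, a', ha', e, hP⟩ := hs h1
        obtain ⟨e, he, hP⟩ := hP.exists_lt (finite_rightSet (finite_listSet Γ))
          (fun t ⟨q, hq, _⟩ => hΓ (q, t.2) hq) he' (fun t ⟨q, hq, _⟩ => hfresh (q, t.2) hq)
        rw [← listSet_rightList] at hP
        exact (h2 (β.child, β.sibling) (mem_boolPairs _) a' ha' e he).not_good ih hP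

theorem BadCert.not_codeNonempty {p : ℕ × List ListConf} (hp : BadCert c p) :
    ¬ CodeNonempty c := by
  rintro ⟨n, ch, a, ha, d, h⟩
  refine (hp.2 ch (by cases ch <;> simp) a ha).not_good (not_listGood_of_badClosed hp.1 n) ?_
  unfold ListGood
  rw [listSet_singleton]
  -- The certificate treats only the initial datum `0`; a single datum can be renamed at will.
  exact h.rename (fun _ => d) (Set.finite_singleton _) rfl (by simp) (by simp)

/-! ### Losing configurations contain small ones -/

/-- The configuration is not winning. -/
def Bad (c : Code) (r : ListConf) : Prop := ∀ n, ¬ ListGood c n r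

/-- The data that occur in a configuration. -/
def confData (r : ListConf) : Finset ℕ := insert r.2.2.1 (r.2.2.2.map Prod.snd).toFinset

/-- The states of the threads with register value `e`. -/
def statesAt (r : ListConf) (e : ℕ) : Finset ℕ :=
  ((r.2.2.2.filter fun t => t.2 = e).map Prod.fst).toFinset

theorem mem_statesAt {r : ListConf} {e q : ℕ} : q ∈ statesAt r e ↔ (q, e) ∈ r.2.2.2 := by
  simp [statesAt]

/-- The data other than that of the node whose set of states is `X`. -/
def dataWith (r : ListConf) (X : Finset ℕ) : Finset ℕ :=
  ((confData r).erase r.2.2.1).filter fun e => statesAt r e = X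

theorem exists_injOn_of_card_le {s t : Finset ℕ} (h : s.card ≤ t.card) :
    ∃ f : ℕ → ℕ, (∀ x ∈ s, f x ∈ t) ∧ Set.InjOn f s := by
  have : Fintype.card s ≤ Fintype.card t := by simpa using h
  obtain ⟨φ⟩ := Function.Embedding.nonempty_of_card_le this
  refine ⟨fun x => if hx : x ∈ s then φ ⟨x, hx⟩ else 0, fun x hx => by simp [hx], ?_⟩
  intro x hx y hy hxy
  simp only [Finset.mem_coe] at hx hy
  simp only [hx, hy, dite_true] at hxy
  simpa using φ.injective (Subtype.ext hxy)

/-- The data other than that of the node are sorted by their exact set of states. Each class of `r`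
injects into the class of `s` with the same set; the classes are disjoint, so the injections combine
to one that respects threads. -/
theorem exists_rename {r s : ListConf}
    (hst : statesAt r r.2.2.1 = statesAt s s.2.2.1)
    (hcard : ∀ e ∈ confData r,
      (dataWith r (statesAt r e)).card ≤ (dataWith s (statesAt r e)).card) :
    ∃ f : ℕ → ℕ, f r.2.2.1 = s.2.2.1 ∧ Set.InjOn f (confData r) ∧
      ∀ t ∈ r.2.2.2, (t.1, f t.2) ∈ s.2.2.2 := by
  classical
  have hex : ∀ X : Finset ℕ, ∃ f : ℕ → ℕ, (dataWith r X).card ≤ (dataWith s X).card →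
      (∀ x ∈ dataWith r X, f x ∈ dataWith s X) ∧ Set.InjOn f (dataWith r X) := by
    intro X
    by_cases h : (dataWith r X).card ≤ (dataWith s X).card
    · obtain ⟨f, hf⟩ := exists_injOn_of_card_le h
      exact ⟨f, fun _ => hf⟩
    · exact ⟨id, fun h' => (h h').elim⟩
  choose φ hφ using hex
  let f : ℕ → ℕ := fun e => if e = r.2.2.1 then s.2.2.1 else φ (statesAt r e) e
  have hself : ∀ e ∈ confData r, e ≠ r.2.2.1 → e ∈ dataWith r (statesAt r e) := by
    intro e he hne
    simp [dataWith, he, hne]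
  have hf0 : f r.2.2.1 = s.2.2.1 := by simp [f]
  have hf : ∀ e, e ≠ r.2.2.1 → f e = φ (statesAt r e) e := fun e he => by simp [f, he]
  have hmem : ∀ e ∈ confData r, e ≠ r.2.2.1 → f e ∈ dataWith s (statesAt r e) := by
    intro e he hne
    rw [hf e hne]
    exact (hφ _ (hcard e he)).1 e (hself e he hne)
  have hne' : ∀ e ∈ confData r, e ≠ r.2.2.1 → f e ≠ s.2.2.1 := by
    intro e he hne
    have := hmem e he hne
    simp only [dataWith, Finset.mem_filter, Finset.mem_erase] at this
    exact this.1.1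
  have hst' : ∀ e ∈ confData r, statesAt s (f e) = statesAt r e := by
    intro e he
    by_cases hne : e = r.2.2.1
    · rw [hne, hf0, hst]
    · have := hmem e he hne
      simp only [dataWith, Finset.mem_filter] at this
      exact this.2
  refine ⟨f, hf0, ?_, ?_⟩
  · intro x hx y hy hxy
    simp only [Finset.mem_coe] at hx hy
    by_cases h1 : x = r.2.2.1 <;> by_cases h2 : y = r.2.2.1
    · rw [h1, h2]
    · subst h1; exact (hne' y hy h2 (hxy ▸ hf0)).elim
    · subst h2; exact (hne' x hx h1 (hxy ▸ hf0)).elim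
    · have hX : statesAt r x = statesAt r y := by rw [← hst' x hx, ← hst' y hy, hxy]
      rw [hf x h1, hf y h2, ← hX] at hxy
      refine (hφ _ (hcard x hx)).2 (hself x hx h1) ?_ hxy
      rw [hX]
      exact hself y hy h2
  · rintro ⟨q, e⟩ ht
    have he : e ∈ confData r := Finset.mem_insert_of_mem (List.mem_toFinset.2
      (List.mem_map.2 ⟨_, ht, rfl⟩))
    rw [← mem_statesAt, hst' e he, mem_statesAt]
    exact ht

/-- Letters and states of the configuration are bounded. -/
def Bounded (c : Code) (B : ℕ) (r : ListConf) : Prop := r.2.1 < c.1 ∧ ∀ t ∈ r.2.2.2, t.1 < B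

/-- Otherwise every `N` has a losing `r N` all of whose losing parts have more than `N` data. Among
suitably sparse members of this sequence, Dickson's lemma embeds an earlier one into a later one.
The image is a losing part of the later one with too few data. -/
theorem exists_small_bad (c : Code) (B : ℕ) : ∃ N, ∀ r, Bad c r → Bounded c B r →
    ∃ Γ : List (ℕ × ℕ), Γ ⊆ r.2.2.2 ∧ Bad c (r.1, r.2.1, r.2.2.1, Γ) ∧
      (confData (r.1, r.2.1, r.2.2.1, Γ)).card ≤ N := by
  by_contra hcon
  push Not at hcon
  choose r hbad hbd hlarge using hcon
  let g : ℕ → ℕ := fun N => (confData (r N)).card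
  have hg : ∀ N, N < g N := fun N => hlarge N _ (List.Subset.refl _) (hbad N)
  -- Iterating `g` makes the lower bound demanded at each stage at least the number of data present
  -- at all earlier stages.
  have hmono : StrictMono fun i => g^[i] 0 := strictMono_nat_of_lt_succ fun i => by
    rw [Function.iterate_succ_apply']
    exact hg _
  let s : ℕ → ListConf := fun i => r (g^[i] 0)
  have hsub : ∀ i e, statesAt (s i) e ∈ (Finset.range B).powerset := by
    intro i e
    rw [Finset.mem_powerset]
    intro q hq
    exact Finset.mem_range.2 ((hbd _).2 _ (mem_statesAt.1 hq))
  let ι := {X // X ∈ (Finset.range B).powerset}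
  let key : ℕ → ((Bool × Bool) × Fin c.1 × ι) × (ι → ℕ) := fun i =>
    (((s i).1, ⟨(s i).2.1, (hbd _).1⟩, ⟨statesAt (s i) (s i).2.2.1, hsub i _⟩),
      fun X => (dataWith (s i) X.1).card)
  obtain ⟨i, j, hij, h1, h2⟩ := WellQuasiOrdered.prod
    (Finite.wellQuasiOrdered (Eq : ((Bool × Bool) × Fin c.1 × ι) → _ → Prop))
    (wellQuasiOrdered_le (α := ι → ℕ)) key
  simp only [key, Prod.mk.injEq, Fin.mk.injEq] at h1
  obtain ⟨hb, ha, hst⟩ := h1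
  obtain ⟨f, hf0, hinj, hf⟩ := exists_rename (r := s i) (s := s j)
    (congrArg Subtype.val hst)
    (fun e _ => h2 ⟨_, hsub i e⟩)
  let Γ : List (ℕ × ℕ) := (s i).2.2.2.map fun t => (t.1, f t.2)
  have hΓsub : Γ ⊆ (s j).2.2.2 := by
    intro t ht
    obtain ⟨u, hu, rfl⟩ := List.mem_map.1 ht
    exact hf u hu
  have hdat : confData ((s j).1, (s j).2.1, (s j).2.2.1, Γ) = (confData (s i)).image f := by
    unfold confData
    rw [Finset.image_insert, hf0]
    congr 1
    ext x
    simp only [Γ, List.map_map, List.mem_toFinset, List.mem_map, Finset.mem_image]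
    constructor
    · rintro ⟨t, ht, rfl⟩
      exact ⟨t.2, ⟨t, ht, rfl⟩, rfl⟩
    · rintro ⟨_, ⟨t, ht, rfl⟩, rfl⟩
      exact ⟨t, ht, rfl⟩
  have hΓbad : Bad c ((s j).1, (s j).2.1, (s j).2.2.1, Γ) := by
    intro n hn
    -- A win from the image would pull back along `f` to a win from `s i`.
    refine hbad _ n (?_ : ListGood c n (s i))
    unfold ListGood at hn ⊢
    simp only at hn
    rw [hb, ha]
    refine hn.rename f (finite_listSet _) hf0 (hinj.mono ?_) ?_
    · rintro x (rfl | ⟨t, ht, rfl⟩)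
      · simp [confData]
      · exact Finset.mem_insert_of_mem (List.mem_toFinset.2 (List.mem_map.2 ⟨_, ht, rfl⟩))
    · exact fun t ht => List.mem_map.2 ⟨t, ht, rfl⟩
  have hlt := hlarge _ Γ hΓsub hΓbad
  rw [hdat] at hlt
  have h3 : (confData (s i)).card = g^[i + 1] 0 := by
    rw [Function.iterate_succ_apply']
  have h4 : g^[i + 1] 0 ≤ g^[j] 0 := hmono.monotone hij
  have h5 := (Finset.card_image_le (s := confData (s i)) (f := f))
  omega

/-! ### Existence of certificates of emptiness -/

/-- All states that occur in the code are less than `B`. -/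
def CodeBound (c : Code) (B : ℕ) : Prop :=
  c.2.1 < B ∧ ∀ q, (codeInstr c q).2.1 < B ∧ (codeInstr c q).2.2 < B

/-- The instruction function takes finitely many values: the entries of the list and the default. -/
theorem exists_codeBound (c : Code) : ∃ B, CodeBound c B := by
  have hfin : (Set.range (codeInstr c)).Finite := by
    refine (finite_listSet ((4, 0, 0) :: c.2.2)).subset ?_
    rintro _ ⟨q, rfl⟩
    unfold codeInstr
    rw [List.getD_eq_getElem?_getD]
    by_cases h : q < c.2.2.length
    · rw [List.getElem?_eq_getElem h]
      exact List.mem_cons_of_mem _ (List.getElem_mem h)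
    · rw [List.getElem?_eq_none (not_lt.1 h)]
      exact List.mem_cons_self
  obtain ⟨B₁, h₁⟩ := (hfin.image fun i => i.2.1).bddAbove
  obtain ⟨B₂, h₂⟩ := (hfin.image fun i => i.2.2).bddAbove
  refine ⟨c.2.1 + B₁ + B₂ + 1, by omega, fun q => ?_⟩
  have h3 : (codeInstr c q).2.1 ≤ B₁ := h₁ ⟨_, ⟨q, rfl⟩, rfl⟩
  have h4 : (codeInstr c q).2.2 ≤ B₂ := h₂ ⟨_, ⟨q, rfl⟩, rfl⟩
  omega

theorem bounded_of_mem_threadSucc {B : ℕ} {b : Bool × Bool} {a d x : ℕ} (hd : d < M) (hx : x < M)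
    {N : List (ℕ × ℕ)} (i : ℕ × ℕ × ℕ) (h1 : i.2.1 < B) (h2 : i.2.2 < B)
    (h : N ∈ threadSucc i M b a d x) : ∀ t ∈ N, t.1 < B ∧ t.2 < M := by
  revert h1 h2 h
  revert i
  apply decodeInstr_cases <;> intros <;> rename_i h1 h2 h t ht <;>
    simp [threadSucc] at h1 h2 h
  · simp [h.2] at ht
  · simp [h.2] at ht
  · simp [h.2] at ht
  · subst h; obtain rfl := List.mem_singleton.1 ht; exact ⟨h1, hd⟩
  · simp [h.2] at ht
  · simp [h.2] at ht
  · subst h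
    rcases List.mem_cons.1 ht with rfl | ht
    · exact ⟨h1, hx⟩
    · obtain rfl := List.mem_singleton.1 ht; exact ⟨h2, hx⟩
  · rcases h with rfl | rfl
    · obtain rfl := List.mem_singleton.1 ht; exact ⟨h1, hx⟩
    · obtain rfl := List.mem_singleton.1 ht; exact ⟨h2, hx⟩
  · obtain ⟨e, he, rfl⟩ := h
    obtain rfl := List.mem_singleton.1 ht; exact ⟨h1, he⟩

theorem bounded_of_mem_epsSucc {B : ℕ} (hB : CodeBound c B) {r : ListConf} (hd : r.2.2.1 < M)
    (hΓ : ∀ t ∈ r.2.2.2, t.1 < B ∧ t.2 < M) {Δ : List (ℕ × ℕ)} (h : Δ ∈ epsSucc c M r) :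
    ∀ t ∈ Δ, t.1 < B ∧ t.2 < M := by
  obtain ⟨t, ht, h⟩ := List.mem_flatMap.1 h
  rcases List.mem_append.1 h with h | h
  · obtain ⟨N, hN, rfl⟩ := List.mem_map.1 h
    intro s hs
    rcases List.mem_append.1 hs with hs | hs
    · exact bounded_of_mem_threadSucc hd (hΓ t ht).2 _ (hB.2 _).1 (hB.2 _).2 hN s hs
    · exact hΓ s (List.mem_of_mem_filter hs)
  · split_ifs at h with hsp
    · obtain rfl := List.mem_singleton.1 h
      intro s hs
      rcases List.mem_append.1 hs with hs | hs
      · obtain ⟨u, hu, hs⟩ := List.mem_flatMap.1 hs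
        split_ifs at hs
        · obtain rfl := List.mem_singleton.1 hs
          exact ⟨(hB.2 _).2, (hΓ u (List.mem_of_mem_filter hu)).2⟩
        · simp at hs
      · exact hΓ s (List.mem_of_mem_filter hs)
    · simp at h

theorem bounded_downList {B : ℕ} (hB : CodeBound c B) {Γ : List (ℕ × ℕ)}
    (hΓ : ∀ t ∈ Γ, t.1 < B ∧ t.2 < M) : ∀ t ∈ downList c Γ, t.1 < B ∧ t.2 < M := by
  intro s hs
  obtain ⟨u, hu, hs⟩ := List.mem_flatMap.1 hs
  split_ifs at hs
  · obtain rfl := List.mem_singleton.1 hs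
    exact ⟨(hB.2 _).1, (hΓ u hu).2⟩
  · simp at hs

theorem bounded_rightList {B : ℕ} (hB : CodeBound c B) {Γ : List (ℕ × ℕ)}
    (hΓ : ∀ t ∈ Γ, t.1 < B ∧ t.2 < M) : ∀ t ∈ rightList c Γ, t.1 < B ∧ t.2 < M := by
  intro s hs
  obtain ⟨u, hu, hs⟩ := List.mem_flatMap.1 hs
  split_ifs at hs
  · obtain rfl := List.mem_singleton.1 hs
    exact ⟨(hB.2 _).1, (hΓ u hu).2⟩
  · simp at hs

open Classical in
/-- All losing configurations with at most `N` data, with states less than `B` and data less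
than `M`. -/
noncomputable def badList (c : Code) (B M N : ℕ) : List ListConf :=
  ((((Finset.univ : Finset (Bool × Bool)) ×ˢ Finset.range c.1 ×ˢ Finset.range M ×ˢ
    (Finset.range B ×ˢ Finset.range M).powerset).image
      fun p => ((p.1, p.2.1, p.2.2.1, p.2.2.2.toList) : ListConf)).filter
    fun r => Bad c r ∧ (confData r).card ≤ N).toList

theorem mem_badList {B N : ℕ} {r : ListConf} (h : r ∈ badList c B M N) :
    r.2.2.1 < M ∧ (∀ t ∈ r.2.2.2, t.1 < B ∧ t.2 < M) ∧ Bad c r ∧ (confData r).card ≤ N := by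
  simp only [badList, Finset.mem_toList, Finset.mem_filter, Finset.mem_image, Finset.mem_product,
    Finset.mem_range, Finset.mem_powerset] at h
  obtain ⟨⟨p, ⟨_, _, h1, h2⟩, rfl⟩, h3, h4⟩ := h
  refine ⟨h1, fun t ht => ?_, h3, h4⟩
  have := h2 (Finset.mem_toList.1 ht)
  simpa using this

/-- `hN` shrinks the configuration to few data; rewriting its threads as the list of a finite set
brings it into `badList`, and neither losing nor the number of data depends on order or repetition.
-/
theorem Bad.badCover {B N : ℕ} (hN : ∀ r, Bad c r → Bounded c B r →
    ∃ Γ : List (ℕ × ℕ), Γ ⊆ r.2.2.2 ∧ Bad c (r.1, r.2.1, r.2.2.1, Γ) ∧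
      (confData (r.1, r.2.1, r.2.2.1, Γ)).card ≤ N) {b : Bool × Bool} {a d : ℕ}
    {Δ : List (ℕ × ℕ)} (h : Bad c (b, a, d, Δ)) (ha : a < c.1) (hd : d < M)
    (hΔ : ∀ t ∈ Δ, t.1 < B ∧ t.2 < M) : BadCover (badList c B M N) b a d Δ := by
  obtain ⟨Γ, hsub, hbad, hcard⟩ := hN _ h ⟨ha, fun t ht => (hΔ t ht).1⟩
  simp only at hsub hbad hcard
  have hset : listSet Γ.toFinset.toList = listSet Γ := by ext; simp [listSet]
  refine ⟨(b, a, d, Γ.toFinset.toList), ?_, rfl, rfl, rfl, fun t ht => hsub ?_⟩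
  · simp only [badList, Finset.mem_toList, Finset.mem_filter, Finset.mem_image,
      Finset.mem_product, Finset.mem_range, Finset.mem_powerset]
    refine ⟨⟨(b, a, d, Γ.toFinset), ⟨Finset.mem_univ _, ha, hd, fun t ht => ?_⟩, rfl⟩, ?_, ?_⟩
    · simpa using hΔ t (hsub (List.mem_toFinset.1 ht))
    · intro n hn
      refine hbad n ?_
      unfold ListGood at hn ⊢
      simp only at hn
      rwa [hset] at hn
    · convert hcard using 2
      ext x
      simp [confData]
  · simpa using ht

theorem exists_badCert (h : ¬ CodeNonempty c) : ∃ p, BadCert c p := by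
  obtain ⟨B, hB⟩ := exists_codeBound c
  obtain ⟨N, hN⟩ := exists_small_bad c B
  -- With `N + 1` values available, a configuration with at most `N` data always leaves one unused.
  refine ⟨(N + 1, badList c B (N + 1) N), ?_, ?_⟩
  · rintro ⟨b, a, d, Γ⟩ hr
    have ha : a < c.1 := by
      simp only [badList, Finset.mem_toList, Finset.mem_filter, Finset.mem_image,
        Finset.mem_product, Finset.mem_range] at hr
      obtain ⟨⟨p, ⟨_, h, _⟩, heq⟩, _⟩ := hr
      cases heq
      exact h
    obtain ⟨hd, hΓ, hbad, hcard⟩ := mem_badList hr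
    refine ⟨?_, hd, fun t ht => (hΓ t ht).2, ?_, fun Δ hΔ => ?_, ?_⟩
    · rintro rfl
      refine hbad 1 ?_
      unfold ListGood
      rw [listSet_nil]
      exact .empty
    · have : ¬ Finset.range (N + 1) ⊆ confData (b, a, d, Γ) := fun hs => by
        have := Finset.card_le_card hs
        rw [Finset.card_range] at this
        omega
      obtain ⟨e, he, hne⟩ := Finset.not_subset.1 this
      refine ⟨e, Finset.mem_range.1 he, ?_, ?_⟩
      · rintro rfl
        exact hne (Finset.mem_insert_self _ _)
      · rintro t ht rfl
        exact hne (Finset.mem_insert_of_mem (List.mem_toFinset.2 (List.mem_map.2 ⟨_, ht, rfl⟩)))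
    · refine Bad.badCover hN (fun n hn => hbad (n + 1) (pre_of_mem_epsSucc hΔ hn)) ha hd ?_
      exact bounded_of_mem_epsSucc hB hd hΓ hΔ
    · by_cases hm : MovingList c Γ
      swap
      · exact .inl hm
      -- If some choice of type, letter and datum for the new node is not covered by `badList`, then
      -- that choice wins.
      have hcov : ∀ {Δ}, (∀ t ∈ Δ, t.1 < B ∧ t.2 < N + 1) →
          ¬ AllCover c (N + 1) (badList c B (N + 1) N) Δ → ∃ n, ∃ β, ∃ a ∈ codeLetters c, ∃ e,
            Good (codeAut c) (codeLetters c) n β a e (listSet Δ) := by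
        intro Δ hΔ hn
        unfold AllCover at hn
        push Not at hn
        obtain ⟨β, _, a, ha, e, he, hnc⟩ := hn
        by_contra hng
        push Not at hng
        exact hnc (Bad.badCover hN (fun n => hng n (toType β) a ha e) ha he hΔ)
      -- If neither direction were covered for all choices, each direction present would have a
      -- winning choice, and the move would win.
      by_contra hcon
      simp only [not_or, not_and] at hcon
      obtain ⟨_, h1, h2, h3⟩ := hcon
      have h2' := fun hb => hcov (bounded_downList hB hΓ) (h2 hb)
      have h3' := fun hb => hcov (bounded_rightList hB hΓ) (h3 hb)
      rw [listSet_downList] at h2'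
      rw [listSet_rightList] at h3'
      obtain ⟨n₁, h2'⟩ : ∃ n, b.1 = true → ∃ β, ∃ a ∈ codeLetters c, ∃ e,
          Good (codeAut c) (codeLetters c) n β a e (downSet (codeAut c) (listSet Γ)) := by
        by_cases hb : b.1 = true
        · obtain ⟨n, h⟩ := h2' hb
          exact ⟨n, fun _ => h⟩
        · exact ⟨0, fun h => (hb h).elim⟩
      obtain ⟨n₂, h3'⟩ : ∃ n, b.2 = true → ∃ β, ∃ a ∈ codeLetters c, ∃ e,
          Good (codeAut c) (codeLetters c) n β a e (rightSet (codeAut c) (listSet Γ)) := by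
        by_cases hb : b.2 = true
        · obtain ⟨n, h⟩ := h3' hb
          exact ⟨n, fun _ => h⟩
        · exact ⟨0, fun h => (hb h).elim⟩
      refine hbad (max n₁ n₂ + 1) (.move (movingList_iff.1 hm) ?_ (fun hb => ?_) fun hb => ?_)
      · obtain ⟨_ | _, _ | _⟩ := b <;> simp_all [toType]
      · obtain ⟨β, a, ha, e, hG⟩ := h2' hb
        exact ⟨β, a, ha, e, hG.mono (le_max_left _ _)⟩
      · obtain ⟨β, a, ha, e, hG⟩ := h3' hb
        exact ⟨β, a, ha, e, hG.mono (le_max_right _ _)⟩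
  · intro ch _ a ha
    refine Bad.badCover hN (fun n hn => h ⟨n, ch, a, ha, 0, ?_⟩) ha (Nat.succ_pos N) ?_
    · unfold ListGood at hn
      rwa [listSet_singleton] at hn
    · intro t ht
      obtain rfl := List.mem_singleton.1 ht
      exact ⟨hB.1, Nat.succ_pos N⟩

theorem not_codeNonempty_iff_exists_badCert : ¬ CodeNonempty c ↔ ∃ p, BadCert c p :=
  ⟨exists_badCert, fun ⟨_, hp⟩ => hp.not_codeNonempty⟩

end ATRA

namespace ATRA

/-! ### Computability of the certificate checks -/

section Primrec

open Primrec

variable {α : Type*} {β : Type*} [Primcodable α] [Primcodable β]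

theorem primrecPred_exists_mem {f : α → List β} {p : α → β → Prop} (hf : Primrec f)
    (hp : PrimrecPred fun z : α × β => p z.1 z.2) : PrimrecPred fun x => ∃ y ∈ f x, p x y :=
  (PrimrecRel.exists_mem_list (R := fun y x => p x y) (PrimrecRel.swap (r := p) hp)).comp hf
    Primrec.id

theorem primrecPred_forall_mem {f : α → List β} {p : α → β → Prop} (hf : Primrec f)
    (hp : PrimrecPred fun z : α × β => p z.1 z.2) : PrimrecPred fun x => ∀ y ∈ f x, p x y :=
  (PrimrecRel.forall_mem_list (R := fun y x => p x y) (PrimrecRel.swap (r := p) hp)).comp hf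
    Primrec.id

theorem primrecPred_exists_lt {f : α → ℕ} {p : α → ℕ → Prop} (hf : Primrec f)
    (hp : PrimrecPred fun z : α × ℕ => p z.1 z.2) : PrimrecPred fun x => ∃ y < f x, p x y :=
  (primrecPred_exists_mem (list_range.comp hf) hp).of_eq fun _ => by simp

theorem primrecPred_forall_lt {f : α → ℕ} {p : α → ℕ → Prop} (hf : Primrec f)
    (hp : PrimrecPred fun z : α × ℕ => p z.1 z.2) : PrimrecPred fun x => ∀ y < f x, p x y :=
  (primrecPred_forall_mem (list_range.comp hf) hp).of_eq fun _ => by simp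

theorem primrecPred_eq {f g : α → β} (hf : Primrec f) (hg : Primrec g) :
    PrimrecPred fun x => f x = g x := Primrec.eq.comp hf hg

theorem primrecPred_mem {f : α → β} {g : α → List β} (hf : Primrec f) (hg : Primrec g) :
    PrimrecPred fun x => f x ∈ g x :=
  (primrecPred_exists_mem (p := fun x y => y = f x) hg
    (primrecPred_eq snd (hf.comp fst))).of_eq fun x => by simp

theorem primrecPred_subset {f g : α → List β} (hf : Primrec f) (hg : Primrec g) :
    PrimrecPred fun x => ∀ t ∈ f x, t ∈ g x :=
  primrecPred_forall_mem hf (primrecPred_mem snd (hg.comp fst))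

theorem primrec_filter_ne [DecidableEq β] {f : α → List β} {g : α → β} (hf : Primrec f)
    (hg : Primrec g) : Primrec fun x => (f x).filter fun s => s ≠ g x :=
  ((PrimrecRel.listFilter (R := fun (s : β) t => s ≠ t)
    (PrimrecRel.not Primrec.eq)).comp hf hg).of_eq fun x => by simp

theorem primrec_singleton {f : α → β} (hf : Primrec f) : Primrec fun x => [f x] :=
  list_cons.comp hf (const [])

/-- Unbounded search through all numbers, each decoded to a candidate and tested. -/
theorem rePred_exists {p : α → β → Prop} (hp : PrimrecPred fun z : α × β => p z.1 z.2) :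
    REPred fun a => ∃ b, p a b := by
  classical
  let f : α → ℕ → Option Unit := fun a n =>
    (Encodable.decode (α := β) n).bind fun b => if p a b then some () else none
  have hf : Primrec₂ f := Primrec.option_bind (Primrec.decode.comp snd)
    (Primrec.ite (hp.comp (Primrec.pair (fst.comp fst) snd)) (const _) (const _))
  refine (Partrec.rfindOpt hf.to_comp).dom_re.of_eq fun a => ?_
  rw [Nat.rfindOpt_dom]
  constructor
  · rintro ⟨n, u, hu⟩
    obtain ⟨b, -, hb⟩ := Option.bind_eq_some_iff.1 hu
    split_ifs at hb with h
    · exact ⟨b, h⟩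
  · rintro ⟨b, hb⟩
    exact ⟨Encodable.encode b, (), by simp [f, hb]⟩

/-! ### Primitive recursiveness of the successor lists and of the emptiness check -/

section Comp

variable {c : α → Code} {M a d x q : α → ℕ} {b : α → Bool × Bool} {i : α → ℕ × ℕ × ℕ}
  {t : α → ℕ × ℕ} {r : α → ListConf} {Γ : α → List (ℕ × ℕ)} {F : α → List ListConf}

theorem primrec_codeInstr (hc : Primrec c) (hq : Primrec q) :
    Primrec fun z => codeInstr (c z) (q z) :=
  (list_getD (4, 0, 0)).comp (snd.comp (snd.comp hc)) hq

theorem primrec_testHolds (hq : Primrec q) (hb : Primrec b) :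
    Primrec fun z => testHolds (q z) (b z) :=
  ite (primrecPred_eq hq (const 0)) (fst.comp hb)
    (ite (primrecPred_eq hq (const 1)) (Primrec.not.comp (fst.comp hb))
      (ite (primrecPred_eq hq (const 2)) (snd.comp hb) (Primrec.not.comp (snd.comp hb))))

theorem primrec_threadSucc (hi : Primrec i) (hM : Primrec M) (hb : Primrec b) (ha : Primrec a)
    (hd : Primrec d) (hx : Primrec x) :
    Primrec fun z => threadSucc (i z) (M z) (b z) (a z) (d z) (x z) := by
  have h1 : Primrec fun z => (i z).1 := fst.comp hi
  have h2 : Primrec fun z => (i z).2.1 := fst.comp (snd.comp hi)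
  have h3 : Primrec fun z => (i z).2.2 := snd.comp (snd.comp hi)
  have hop : ∀ n : ℕ, PrimrecPred fun z => (i z).1 = n := fun n => primrecPred_eq h1 (const n)
  have hyes : Primrec fun _ : α => ([[]] : List (List (ℕ × ℕ))) := const _
  have hno : Primrec fun _ : α => ([] : List (List (ℕ × ℕ))) := const _
  unfold threadSucc
  refine ite (hop 0) (ite (primrecPred_eq h2 ha) hyes hno) ?_
  refine ite (hop 1) (ite (primrecPred_eq h2 ha) hno hyes) ?_
  refine ite (hop 2) (ite (primrecPred_eq (primrec_testHolds h2 hb) (const true)) hyes hno) ?_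
  refine ite (hop 3) (primrec_singleton (primrec_singleton (h2.pair hd))) ?_
  refine ite (hop 4) (ite (primrecPred_eq hd hx) hyes hno) ?_
  refine ite (hop 5) (ite (primrecPred_eq hd hx) hno hyes) ?_
  refine ite (hop 6) (primrec_singleton (list_cons.comp (h2.pair hx)
    (primrec_singleton (h3.pair hx)))) ?_
  refine ite (hop 7) (list_cons.comp (primrec_singleton (h2.pair hx))
    (primrec_singleton (primrec_singleton (h3.pair hx)))) ?_
  refine ite (hop 10) (list_map (list_range.comp hM) ?_) hno
  exact primrec_singleton ((h2.comp fst).pair snd)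

theorem primrec_spreadList (ha : Primrec a) (hd : Primrec d) (hΓ : Primrec Γ) :
    Primrec fun z => spreadList (a z) (d z) (Γ z) :=
  list_flatMap hΓ (ite (primrecPred_eq (fst.comp snd) (ha.comp fst))
    (primrec_singleton ((hd.comp fst).pair (snd.comp snd))) (const []))

theorem primrec_downList (hc : Primrec c) (hΓ : Primrec Γ) :
    Primrec fun z => downList (c z) (Γ z) := by
  have h : Primrec fun z : α × (ℕ × ℕ) => codeInstr (c z.1) z.2.1 :=
    primrec_codeInstr (hc.comp fst) (fst.comp snd)
  exact list_flatMap hΓ (ite (primrecPred_eq (fst.comp h) (const 8))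
    (primrec_singleton ((fst.comp (snd.comp h)).pair (snd.comp snd))) (const []))

theorem primrec_rightList (hc : Primrec c) (hΓ : Primrec Γ) :
    Primrec fun z => rightList (c z) (Γ z) := by
  have h : Primrec fun z : α × (ℕ × ℕ) => codeInstr (c z.1) z.2.1 :=
    primrec_codeInstr (hc.comp fst) (fst.comp snd)
  exact list_flatMap hΓ (ite (primrecPred_eq (fst.comp h) (const 9))
    (primrec_singleton ((fst.comp (snd.comp h)).pair (snd.comp snd))) (const []))

theorem primrecPred_movingList (hc : Primrec c) (hΓ : Primrec Γ) :
    PrimrecPred fun z => MovingList (c z) (Γ z) := by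
  have h : Primrec fun z : α × (ℕ × ℕ) => codeInstr (c z.1) z.2.1 :=
    primrec_codeInstr (hc.comp fst) (fst.comp snd)
  exact primrecPred_forall_mem hΓ ((primrecPred_eq (fst.comp h) (const 8)).or
    (primrecPred_eq (fst.comp h) (const 9)))

theorem primrecPred_spreadReady (hc : Primrec c) (hΓ : Primrec Γ) :
    PrimrecPred fun z => SpreadReady (c z) (Γ z) := by
  have h : Primrec fun z : α × (ℕ × ℕ) => codeInstr (c z.1) z.2.1 :=
    primrec_codeInstr (hc.comp fst) (fst.comp snd)
  exact primrecPred_forall_mem hΓ ((nat_le.comp (const 11) (fst.comp h)).or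
    ((primrecPred_eq (fst.comp h) (const 8)).or (primrecPred_eq (fst.comp h) (const 9))))

theorem primrec_rewriteSucc (hc : Primrec c) (hM : Primrec M) (hr : Primrec r) (ht : Primrec t) :
    Primrec fun z => rewriteSucc (c z) (M z) (r z) (t z) := by
  have hi : Primrec fun z => codeInstr (c z) (t z).1 := primrec_codeInstr hc (fst.comp ht)
  have hr1 : Primrec fun z => (r z).2.1 := fst.comp (snd.comp hr)
  have hr2 : Primrec fun z => (r z).2.2.1 := fst.comp (snd.comp (snd.comp hr))
  have hΔ : Primrec fun z => (r z).2.2.2.filter fun s => s ≠ t z :=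
    primrec_filter_ne (snd.comp (snd.comp (snd.comp hr))) ht
  refine list_append.comp (list_map (primrec_threadSucc hi hM (fst.comp hr) hr1 hr2
    (snd.comp ht)) (list_append.comp snd (hΔ.comp fst))) (ite ?_ ?_ (const []))
  · exact (nat_le.comp (const 11) (fst.comp hi)).and (primrecPred_spreadReady hc hΔ)
  · exact primrec_singleton (list_append.comp (primrec_spreadList (fst.comp (snd.comp hi))
      (snd.comp (snd.comp hi)) hΔ) hΔ)

theorem primrec_epsSucc (hc : Primrec c) (hM : Primrec M) (hr : Primrec r) :
    Primrec fun z => epsSucc (c z) (M z) (r z) :=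
  list_flatMap (snd.comp (snd.comp (snd.comp hr)))
    (primrec_rewriteSucc (hc.comp fst) (hM.comp fst) (hr.comp fst) snd)

theorem primrecPred_badCover (hF : Primrec F) (hb : Primrec b) (ha : Primrec a) (hd : Primrec d)
    (hΓ : Primrec Γ) : PrimrecPred fun z => BadCover (F z) (b z) (a z) (d z) (Γ z) := by
  have hg : Primrec fun z : α × ListConf => z.2 := snd
  refine primrecPred_exists_mem hF ((primrecPred_eq (fst.comp hg) (hb.comp fst)).and
    ((primrecPred_eq (fst.comp (snd.comp hg)) (ha.comp fst)).and
    ((primrecPred_eq (fst.comp (snd.comp (snd.comp hg))) (hd.comp fst)).and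
    (primrecPred_subset (snd.comp (snd.comp (snd.comp hg))) (hΓ.comp fst)))))

theorem primrecPred_allCover (hc : Primrec c) (hM : Primrec M) (hF : Primrec F)
    (hΓ : Primrec Γ) : PrimrecPred fun z => AllCover (c z) (M z) (F z) (Γ z) := by
  refine primrecPred_forall_mem (const boolPairs) ?_
  refine primrecPred_forall_lt (fst.comp (hc.comp fst)) ?_
  refine primrecPred_forall_lt (hM.comp (fst.comp fst)) ?_
  have h0 : Primrec fun z : ((α × (Bool × Bool)) × ℕ) × ℕ => z.1.1.1 :=
    fst.comp (fst.comp fst)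
  exact primrecPred_badCover (hF.comp h0) (snd.comp (fst.comp fst)) (snd.comp fst) snd
    (hΓ.comp h0)

theorem primrecPred_badClosed (hc : Primrec c) (hM : Primrec M) (hF : Primrec F)
    (hr : Primrec r) : PrimrecPred fun z => BadClosed (c z) (M z) (F z) (r z) := by
  have hb : Primrec fun z => (r z).1 := fst.comp hr
  have ha : Primrec fun z => (r z).2.1 := fst.comp (snd.comp hr)
  have hd : Primrec fun z => (r z).2.2.1 := fst.comp (snd.comp (snd.comp hr))
  have hΓ : Primrec fun z => (r z).2.2.2 := snd.comp (snd.comp (snd.comp hr))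
  refine (primrecPred_eq hΓ (const [])).not.and ((nat_lt.comp hd hM).and
    (.and ?_ (.and ?_ (.and ?_ ?_))))
  · exact primrecPred_forall_mem hΓ (nat_lt.comp (snd.comp snd) (hM.comp fst))
  · exact primrecPred_exists_lt hM ((primrecPred_eq snd (hd.comp fst)).not.and
      (primrecPred_forall_mem (hΓ.comp fst)
        (primrecPred_eq (snd.comp snd) (snd.comp fst)).not))
  · exact primrecPred_forall_mem (primrec_epsSucc hc hM hr)
      (primrecPred_badCover (hF.comp fst) (hb.comp fst) (ha.comp fst) (hd.comp fst) snd)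
  · refine (primrecPred_movingList hc hΓ).not.or (.or ?_ (.or ?_ ?_))
    · exact (primrecPred_eq (fst.comp hb) (const false)).and
        (primrecPred_eq (snd.comp hb) (const false))
    · exact (primrecPred_eq (fst.comp hb) (const true)).and
        (primrecPred_allCover hc hM hF (primrec_downList hc hΓ))
    · exact (primrecPred_eq (snd.comp hb) (const true)).and
        (primrecPred_allCover hc hM hF (primrec_rightList hc hΓ))

end Comp

theorem primrecPred_badCert :
    PrimrecPred fun z : Code × (ℕ × List ListConf) => BadCert z.1 z.2 := by
  refine .and (primrecPred_forall_mem (snd.comp snd) (primrecPred_badClosed (fst.comp fst)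
    (fst.comp (snd.comp fst)) (snd.comp (snd.comp fst)) snd)) ?_
  refine primrecPred_forall_mem (const [false, true]) ?_
  refine primrecPred_forall_lt (fst.comp (fst.comp fst)) ?_
  have h0 : Primrec fun z : ((Code × (ℕ × List ListConf)) × Bool) × ℕ => z.1.1 := fst.comp fst
  exact primrecPred_badCover (snd.comp (snd.comp h0)) ((snd.comp fst).pair (const false)) snd
    (const 0) (primrec_singleton ((fst.comp (snd.comp (fst.comp h0))).pair (const 0)))

theorem primrecPred_goodJust {c : α → Code} {M : α → ℕ} {L : α → List (ℕ × ListConf)}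
    {s : α → ℕ × ListConf} (hc : Primrec c) (hM : Primrec M) (hL : Primrec L) (hs : Primrec s) :
    PrimrecPred fun z => GoodJust (c z) (M z) (L z) (s z) := by
  have hr : Primrec fun z => (s z).2 := snd.comp hs
  have hb : Primrec fun z => (s z).2.1 := fst.comp hr
  have ha : Primrec fun z => (s z).2.2.1 := fst.comp (snd.comp hr)
  have hd : Primrec fun z => (s z).2.2.2.1 := fst.comp (snd.comp (snd.comp hr))
  have hΓ : Primrec fun z => (s z).2.2.2.2 := snd.comp (snd.comp (snd.comp hr))
  have hmove : ∀ {Δ : α → List (ℕ × ℕ)}, Primrec Δ → PrimrecPred fun z =>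
      ∃ g ∈ L z, g.1 < (s z).1 ∧ g.2.2.1 < (c z).1 ∧ ∀ t ∈ Δ z, t ∈ g.2.2.2.2 := by
    intro Δ hΔ
    have hg : Primrec fun z : α × (ℕ × ListConf) => z.2.2 := snd.comp snd
    exact primrecPred_exists_mem hL ((nat_lt.comp (fst.comp snd) (fst.comp (hs.comp fst))).and
      ((nat_lt.comp (fst.comp (snd.comp hg)) (fst.comp (hc.comp fst))).and
      (primrecPred_subset (hΔ.comp fst) (snd.comp (snd.comp (snd.comp hg))))))
  refine .or (primrecPred_eq hΓ (const [])) (.or ?_ ?_)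
  · refine primrecPred_exists_mem (primrec_epsSucc hc hM hr) ?_
    refine primrecPred_exists_mem (hL.comp fst) ?_
    have h0 : Primrec fun z : (α × List (ℕ × ℕ)) × (ℕ × ListConf) => z.1.1 := fst.comp fst
    have hg : Primrec fun z : (α × List (ℕ × ℕ)) × (ℕ × ListConf) => z.2.2 := snd.comp snd
    exact (nat_lt.comp (fst.comp snd) (fst.comp (hs.comp h0))).and
      ((primrecPred_eq (fst.comp hg) (hb.comp h0)).and
      ((primrecPred_eq (fst.comp (snd.comp hg)) (ha.comp h0)).and
      ((primrecPred_eq (fst.comp (snd.comp (snd.comp hg))) (hd.comp h0)).and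
      (primrecPred_subset (snd.comp fst) (snd.comp (snd.comp (snd.comp hg)))))))
  · refine (primrecPred_movingList hc hΓ).and (.and ?_ (.and ?_ ?_))
    · exact (primrecPred_eq (fst.comp hb) (const true)).or
        (primrecPred_eq (snd.comp hb) (const true))
    · exact (primrecPred_eq (fst.comp hb) (const false)).or (hmove (primrec_downList hc hΓ))
    · exact (primrecPred_eq (snd.comp hb) (const false)).or (hmove (primrec_rightList hc hΓ))

theorem primrecPred_goodCert :
    PrimrecPred fun z : Code × (ℕ × List (ℕ × ListConf)) => GoodCert z.1 z.2 := by
  refine .and (primrecPred_forall_mem (snd.comp snd) (primrecPred_goodJust (fst.comp fst)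
    (fst.comp (snd.comp fst)) (snd.comp (snd.comp fst)) snd)) ?_
  refine primrecPred_exists_mem (snd.comp snd) ?_
  have hc : Primrec fun z : (Code × (ℕ × List (ℕ × ListConf))) × (ℕ × ListConf) => z.1.1 :=
    fst.comp fst
  have hg : Primrec fun z : (Code × (ℕ × List (ℕ × ListConf))) × (ℕ × ListConf) => z.2.2 :=
    snd.comp snd
  exact (primrecPred_eq (snd.comp (fst.comp hg)) (const false)).and
    ((nat_lt.comp (fst.comp (snd.comp hg)) (fst.comp hc)).and
    (primrecPred_mem ((fst.comp (snd.comp hc)).pair (fst.comp (snd.comp (snd.comp hg))))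
      (snd.comp (snd.comp (snd.comp hg)))))

end Primrec

/-- Post's theorem: the predicate and its complement are recursively enumerable, by search for the
respective certificates. -/
theorem computablePred_codeNonempty : ComputablePred CodeNonempty := by
  rw [ComputablePred.computable_iff_re_compl_re']
  exact ⟨(rePred_exists primrecPred_goodCert).of_eq fun _ =>
      codeNonempty_iff_exists_goodCert.symm,
    (rePred_exists primrecPred_badCert).of_eq fun _ =>
      not_codeNonempty_iff_exists_badCert.symm⟩

end ATRA

theorem mainTheorem2 (D : Type u) [Infinite D] :
    ∃ isEmpty : ATRA.Code → Bool, Computable isEmpty ∧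
      ∀ (Alph : Type v) (Q : Type w) (k m : ℕ) (eA : Alph ≃ Fin k) (eQ : Q ≃ Fin m)
        (A : ATRA.Automaton Alph Q),
        isEmpty (A.code eA eQ) = true ↔ A.language D = ∅ := by
  classical
  -- The truth value is taken classically; computability comes from the previous theorem. The
  -- function does not depend on `D`, as `CodeNonempty` speaks of data in `ℕ`.
  refine ⟨fun c => decide (¬ ATRA.CodeNonempty c),
    ATRA.computablePred_codeNonempty.not.decide, fun Alph Q k m eA eQ A => ?_⟩
  rw [decide_eq_true_iff, ← ATRA.language_nonempty_iff_code A eA eQ D,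
    Set.not_nonempty_iff_eq_empty]
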